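/- Let $n\ge 2$. Let $\mathcal{VS}_n\subset\mathbb{C}$ be the $n$-th Vicsek set, normalized so that its center is $q_0=0$, its boundary points are $q_j=i^{\,j-1}$ ($j=1,\dots,4$), and its four half-diagonals $[q_0,q_j]$ have length $1$. That is, with the $4n-3$ similarities $F(z)=c+\frac{z}{2n-1}$, where $c=0$ or $c=\frac{2k}{2n-1}q_j$ ($1\le k\le n-1$, $1\le j\le 4$), and $V_m=\bigcup_{|w|=m}F_w\{q_1,\dots,q_4\}$, $\mathcal{VS}_n$ is the closure of $\bigcup_m V_m$. Let $\mu$ be the standard self-similar probability measure, which gives every cell $F_w(\mathcal{VS}_n)$, $|w|=m$, mass $(4n-3)^{-m}$. Let $\mathcal E(u,v)$ be the limit as $m\to\infty$ of $$\tfrac14(2n-1)^m\sum_{|w|=m}\ \sum_{1\le i<j\le 4}\bigl(u(F_wq_i)-u(F_wq_j)\bigr)\bigl(v(F_wq_i)-v(F_wq_j)\bigr).$$ The constant $\frac14$ normalizes $\mathcal E(u,v)$ to be the sum of the one-dimensional energies $\int u'v'$ (with respect to arc length) over the line segments of the skeleton of $\mathcal{VS}_n$. Let $\mathrm{dom}\,\mathcal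 E$ be the set of continuous functions on $\mathcal{VS}_n$ of finite energy, and let $\mathrm{dom}_0\,\mathcal E$ be the set of those vanishing at $q_1,\dots,q_4$. For continuous $f$ and $u\in\mathrm{dom}\,\mathcal E$, $\Delta u=f$ means $\mathcal E(u,v)=-\int fv\,d\mu$ for all $v\in\mathrm{dom}_0\,\mathcal E$. A Dirichlet Green's function is a function $G$ on $\mathcal{VS}_n\times\mathcal{VS}_n$ such that for every $y$ we have $G(\cdot,y)\in\mathrm{dom}_0\,\mathcal E$ and $-\Delta G(\cdot,y)=\delta_y$, i.e. $\mathcal E(G(\cdot,y),v)=v(y)$ for all $v\in\mathrm{dom}_0\,\mathcal E$. For $x,y\in\mathcal{VS}_n$ let $[x,y]$ be the unique path in $\mathcal{VS}_n$ from $x$ to $y$ and $d(x,y)$ its length. Every $x\in\mathcal{VS}_n$ attaches to the union $D$ of the two main diagonals at a unique point $z(x)\in D$, the one with $[x,z(x)]\cap D=\{z(x)\}$. Put $d'(x)=d(q_0,z(x))$. The point $x$ lies on the $j$-th arm if $z(x)\in[q_0,q_j]$; every point lies on some arm, and $q_0$ lies on all four. Then a Dirichlet Green's function $G$ exists. For every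 Dirichlet Green's function $G$ and every continuous $f$, the function $u(x)=\int G(x,y)f(y)\,d\mu(y)$ lies in $\mathrm{dom}_0\,\mathcal E$ and satisfies $-\Delta u=f$. Moreover $G$ is given on all of $\mathcal{VS}_n\times\mathcal{VS}_n$ (so it is unique) as follows. * If $x$ and $y$ lie on different arms, then $$G(x,y)=\frac{(1-d'(x))(1-d'(y))}{4}.$$ * If $x$ and $y$ lie on the same arm and $d'(x)<d'(y)$, then $$G(x,y)=\frac{(1-d'(y))(3d'(x)+1)}{4}.$$ * If $x$ and $y$ lie on the same arm and $d'(y)<d'(x)$, then $$G(x,y)=\frac{(1-d'(x))(3d'(y)+1)}{4}.$$ * If $x$ and $y$ lie on the same arm and $d'(x)=d'(y)$, then, with $z=z(x)=z(y)$, $$G(x,y)=\frac{(1-d'(y))(3d'(y)+1)}{4}+d(z,w(x,y)),$$ where $w(x,y)$ is the unique last common point of the paths $[z,x]$ and $[z,y]$. -/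

import Mathlib

open Filter Topology MeasureTheory
open scoped MeasureTheory

noncomputable section

namespace Vicsek

/-! ## The Vicsek set `VS_n`

The picture is the usual one (a unit square with its two diagonals), moved by a similarity of the
plane `ℂ`: the centre `q_0` of the square is the origin, each half-diagonal (arm) has length `1`,
and the two main diagonals lie along the coordinate axes. -/

/-- The four boundary points `1, i, -1, -i`. -/
def corner (j : Fin 4) : ℂ := Complex.I ^ (j : ℕ)

/-- Labels of the `4 n - 3` similarities: one central cell, and `n - 1` further cells on each of
the four arms. -/
abbrev Idx (n : ℕ) : Type := Unit ⊕ (Fin 4 × Fin (n - 1))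

/-- Centre of the first level cell with a given label; the diagonals of these cells have half-length
`1 / (2 n - 1)` and follow each other along the arms. -/
def cellCenter (n : ℕ) : Idx n → ℂ
  | Sum.inl _ => 0
  | Sum.inr (j, k) => ((2 * ((k : ℕ) + 1) / (2 * n - 1) : ℝ) : ℂ) * corner j

/-- The similarities `F_i`, of ratio `1 / (2 n - 1)`. -/
def F (n : ℕ) (i : Idx n) (z : ℂ) : ℂ := cellCenter n i + z / (2 * n - 1)

/-- `F_w = F_{w_1} ∘ ⋯ ∘ F_{w_m}`. -/
def wordMap (n : ℕ) {m : ℕ} (w : Fin m → Idx n) (z : ℂ) : ℂ :=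
  (List.ofFn w).foldr (F n) z

/-- Vertices of the `m`-th graph approximation `Γ_m`. -/
def vertices (n m : ℕ) : Set ℂ :=
  {z | ∃ (w : Fin m → Idx n) (j : Fin 4), z = wordMap n w (corner j)}

/-- The Vicsek set `VS_n`: the limit of the increasing sequence of vertex sets. -/
def VS (n : ℕ) : Set ℂ := closure (⋃ m, vertices n m)

/-! ## The standard measure -/

/-- The point of `VS_n` with a given infinite address,
`lim_m F_{ω_0} ∘ ⋯ ∘ F_{ω_m} (0)`. -/
def coding (n : ℕ) (ω : ℕ → Idx n) : ℂ :=
  ∑' k : ℕ, cellCenter n (ω k) / (2 * n - 1) ^ k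

/-- The standard self-similar probability measure, in which every `m`-cell has mass
`(4 n - 3)^(-m)`: the image of the uniform Bernoulli measure on addresses. -/
def stdMeasure (n : ℕ) : Measure ℂ :=
  (Measure.infinitePi (fun _ : ℕ => (PMF.uniformOfFintype (Idx n)).toMeasure)).map (coding n)

/-! ## Energy and Laplacian -/

/-- The graph energy form on `Γ_m`, in which the four vertices of each `m`-cell are joined in pairs
by an edge. -/
def graphEnergy (n m : ℕ) (u v : ℂ → ℝ) : ℝ :=
  ∑ w : Fin m → Idx n, ∑ i : Fin 4, ∑ j ∈ Finset.Ioi i,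
    (u (wordMap n w (corner i)) - u (wordMap n w (corner j))) *
      (v (wordMap n w (corner i)) - v (wordMap n w (corner j)))

/-- The renormalized graph energy form. The factor `(2 n - 1)^m` is the renormalization; the factor
`1 / 4` fixes the scale so that the limit is `∑_j ∫ u' v'`, the sum of the one-dimensional energies
over the line segments of the skeleton, arc length being measured with arms of length `1`.
(For a function which is linear on each of the four half-diagonals of a cell with half-diagonals of
length `ℓ`, and harmonic at the centre of the cell, the sum of the one-dimensional energies is
`(4 ℓ)⁻¹ ∑_{i<j} (u_i - u_j)²`, and `ℓ = (2 n - 1)^(-m)` for an `m`-cell.) -/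
def renormEnergy (n m : ℕ) (u v : ℂ → ℝ) : ℝ :=
  (1 / 4) * (2 * (n : ℝ) - 1) ^ m * graphEnergy n m u v

/-- `ℰ(u, v) = e`, where `ℰ` is the limit of the renormalized graph energies. -/
def HasEnergy (n : ℕ) (u v : ℂ → ℝ) (e : ℝ) : Prop :=
  Tendsto (fun m => renormEnergy n m u v) atTop (𝓝 e)

/-- `u ∈ dom ℰ`: continuous functions on `VS_n` of finite energy. Functions on `VS_n` are written
as functions on `ℂ` of which only the values on `VS_n` matter. -/
def InDom (n : ℕ) (u : ℂ → ℝ) : Prop :=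
  ContinuousOn u (VS n) ∧ ∃ e : ℝ, HasEnergy n u u e

/-- `u ∈ dom₀ ℰ`: moreover `u` vanishes at the four boundary points. -/
def InDomZero (n : ℕ) (u : ℂ → ℝ) : Prop :=
  InDom n u ∧ ∀ j : Fin 4, u (corner j) = 0

/-- `Δ u = f` in the weak formulation: `ℰ(u, v) = - ∫ f v dμ` for all `v ∈ dom₀ ℰ`. -/
def HasLaplacian (n : ℕ) (u f : ℂ → ℝ) : Prop :=
  ContinuousOn f (VS n) ∧ InDom n u ∧
    ∀ v : ℂ → ℝ, InDomZero n v →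
      HasEnergy n u v (-∫ x in VS n, f x * v x ∂(stdMeasure n))

/-- `G` is a Dirichlet Green's function: for every `y`, the function `G(·, y)` lies in `dom ℰ`,
vanishes on the boundary, and satisfies `-Δ G(·, y) = δ_y`, i.e.
`ℰ(G(·, y), v) = ∫ v dδ_y = v(y)` for all `v ∈ dom₀ ℰ`. -/
def IsDirichletGreen (n : ℕ) (G : ℂ → ℂ → ℝ) : Prop :=
  ∀ y ∈ VS n, InDomZero n (fun x => G x y) ∧
    ∀ v : ℂ → ℝ, InDomZero n v → HasEnergy n (fun x => G x y) v (v y)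

/-! ## Paths and distances in `VS_n` -/

/-- The unique path (arc) in `VS_n` from `x` to `y`, as a set: the points through which every curve
in `VS_n` from `x` to `y` must pass. -/
def pathSet (n : ℕ) (x y : ℂ) : Set ℂ :=
  {p | ∀ γ : Path x y, Set.range γ ⊆ VS n → p ∈ Set.range γ}

/-- The distance `d(x, y)`, measured along the path: the length (one-dimensional Hausdorff measure)
of the path from `x` to `y`. -/
def pathDist (n : ℕ) (x y : ℂ) : ℝ := (μH[1] (pathSet n x y)).toReal

/-- The half-diagonal from the centre to the boundary point `corner j`. -/
def halfDiagonal (j : Fin 4) : Set ℂ := segment ℝ 0 (corner j)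

/-- The union of the two main diagonals. -/
def diagonals : Set ℂ := ⋃ j, halfDiagonal j

/-- `z` is the point of the main diagonals at which `x` attaches: the path from `x` to `z` meets the
main diagonals only in its endpoint `z`. -/
def AttachesAt (n : ℕ) (x z : ℂ) : Prop :=
  z ∈ diagonals ∧ pathSet n x z ∩ diagonals = {z}

/-- `x` lies on the `j`-th arm of `VS_n`: the half-diagonal together with everything that attaches
to it (the centre lies on all four arms). -/
def OnArm (n : ℕ) (j : Fin 4) (x : ℂ) : Prop :=
  x ∈ VS n ∧ ∃ z ∈ halfDiagonal j, AttachesAt n x z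

/-- `w` is the last point in the intersection of the paths from `z` to `x` and from `z` to `y`. -/
def IsLastCommon (n : ℕ) (z x y w : ℂ) : Prop :=
  w ∈ pathSet n z x ∩ pathSet n z y ∧ pathSet n z x ∩ pathSet n z y ⊆ pathSet n z w

end Vicsek

end

/-! The Vicsek set is a tree, and on a tree differences of distance functions are explicit
potentials. The function d(·,y) - d(·,y') is constant on every branch off the path from y to y', and
has slope 2 along that path, so its energy against v is -2(v(y) - v(y')). Differences are essential:
d(·,y) alone has slope 1 on a skeleton of infinite length. Averaging the d(·,y) - d(·,q_j) with the
harmonic weights of y at the four corners, multiplying by -1/2 and adding a constant gives `green`,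
which is symmetric, vanishes at the corners and reproduces v(y). Symmetry yields uniqueness: the
energy of G(·,y) against `green`(·,x) equals both G(x,y) and `green`(y,x).

The energy identity follows from self-similarity. Retracting onto the cell i collapses the rest of
the set to corners of the cell, and on that cell the distance to y is a scaled copy of the distance
to the retracted point, plus a constant (`pathDist_F_left`). Hence the error `defect` at level m + 1
is a sum over cells of errors at level m (`defect_succ`). Errors between corners vanish
(`defect_corners`), so only a cell holding y contributes, and iteration bounds the error by a
multiple of the oscillation of v on m-cells (`abs_defect_le`). This needs only continuity of v and
is uniform in y, which allows integration against f.

The geometric input is that paths, defined as sets of unavoidable points, behave like arcs in a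
tree: they scale under the similarities (`pathSet_F`), have finite length (`exists_joinedIn_zero`),
and add up (`pathDist_add`). The explicit formula comes from `green_eq`, which contains the Gromov
product of x and y at the centre; attachment points and medians (`exists_median`) compute that
product. -/

/-- A path ending in a closed set has a first point in that set. -/
theorem Path.exists_first_hit {X : Type*} [TopologicalSpace X] {S C : Set X} {x y : X}
    (γ : Path x y) (hγ : Set.range γ ⊆ S) (hC : IsClosed C) (hy : y ∈ C) :
    ∃ z ∈ C, z ∈ Set.range γ ∧ JoinedIn (S \ C ∪ {z}) x z := by
  have hT : IsCompact (Set.Icc (0 : ℝ) 1 ∩ γ.extend ⁻¹' C) :=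
    isCompact_Icc.inter_right (hC.preimage γ.extend.continuous)
  obtain ⟨t, ⟨ht, htC⟩, hmin⟩ := hT.exists_isLeast ⟨1, by simp, by simpa using hy⟩
  refine ⟨γ.extend t, htC, ?_, ?_⟩
  · rw [← γ.extend_range]; exact ⟨t, rfl⟩
  · have hp : IsPathConnected (γ.extend '' Set.Icc 0 t) :=
      ((convex_Icc (0 : ℝ) t).isPathConnected ⟨0, by simp [ht.1]⟩).image γ.extend.continuous
    have := hp.joinedIn x ⟨0, by simp [ht.1], by simp⟩ (γ.extend t) ⟨t, by simp [ht.1], rfl⟩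
    refine this.mono ?_
    rintro _ ⟨s, hs, rfl⟩
    by_cases hsC : γ.extend s ∈ C
    · right
      have : t ≤ s := hmin ⟨⟨hs.1, hs.2.trans ht.2⟩, hsC⟩
      rw [le_antisymm hs.2 this]; rfl
    · left
      refine ⟨hγ ?_, hsC⟩
      rw [← γ.extend_range]; exact ⟨s, rfl⟩

theorem Path.joinedIn_range {X : Type*} [TopologicalSpace X] {x y z : X}
    (γ : Path x y) (hz : z ∈ Set.range γ) : JoinedIn (Set.range γ) x z := by
  have hp : IsPathConnected (γ.extend '' Set.univ) :=
    (convex_univ.isPathConnected Set.univ_nonempty).image γ.extend.continuous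
  rw [Set.image_univ, γ.extend_range] at hp
  exact hp.joinedIn x ⟨0, by simp⟩ z hz

noncomputable section

namespace Vicsek

variable {n : ℕ} {x y z p q : ℂ}

/-! ## Path sets in general -/

/-- Negating the definition turns statements about all curves into connectivity of a punctured set,
so that the algebra of paths reduces to concatenating and restricting joins. -/
theorem notMem_pathSet_iff : p ∉ pathSet n x y ↔ JoinedIn (VS n \ {p}) x y := by
  simp only [pathSet, Set.mem_ofPred_eq, not_forall]
  constructor
  · rintro ⟨γ, h1, h2⟩
    exact ⟨γ, fun t => ⟨h1 ⟨t, rfl⟩, fun h => h2 ⟨t, h⟩⟩⟩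
  · rintro ⟨γ, h⟩
    refine ⟨γ, ?_, ?_⟩
    · rintro _ ⟨t, rfl⟩; exact (h t).1
    · rintro ⟨t, ht⟩; exact (h t).2 ht

theorem pathSet_comm (n : ℕ) (x y : ℂ) : pathSet n x y = pathSet n y x := by
  ext p
  rw [← not_iff_not, notMem_pathSet_iff, notMem_pathSet_iff]
  exact ⟨JoinedIn.symm, JoinedIn.symm⟩

theorem left_mem_pathSet (n : ℕ) (x y : ℂ) : x ∈ pathSet n x y := fun γ _ => ⟨0, by simp⟩

theorem right_mem_pathSet (n : ℕ) (x y : ℂ) : y ∈ pathSet n x y := fun γ _ => ⟨1, by simp⟩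

theorem pathSet_subset_of_joinedIn {A : Set ℂ} (hA : A ⊆ VS n) (h : JoinedIn A x y) :
    pathSet n x y ⊆ A := by
  obtain ⟨γ, hγ⟩ := h
  intro p hp
  obtain ⟨t, rfl⟩ := hp γ (by rintro _ ⟨t, rfl⟩; exact hA (hγ t))
  exact hγ t

theorem isClosed_pathSet (n : ℕ) (x y : ℂ) : IsClosed (pathSet n x y) := by
  have : pathSet n x y = ⋂ (γ : Path x y) (_ : Set.range γ ⊆ VS n), Set.range γ := by
    ext p; simp [pathSet]
  rw [this]
  exact isClosed_iInter fun γ => isClosed_iInter fun _ =>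
    (isCompact_range γ.continuous).isClosed

theorem pathSet_subset_union (n : ℕ) (x y p : ℂ) :
    pathSet n x y ⊆ pathSet n x p ∪ pathSet n p y := by
  intro q hq
  by_contra h
  simp only [Set.mem_union, not_or, notMem_pathSet_iff] at h
  exact notMem_pathSet_iff.2 (h.1.trans h.2) hq

theorem pathSet_left_subset (h : p ∈ pathSet n x y) : pathSet n x p ⊆ pathSet n x y := by
  intro q hq γ hγ
  by_contra hqγ
  refine notMem_pathSet_iff.2 ((γ.joinedIn_range (h γ hγ)).mono ?_) hq
  exact fun a ha => ⟨hγ ha, fun e => hqγ (e ▸ ha)⟩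

theorem pathSet_right_subset (h : p ∈ pathSet n x y) : pathSet n p y ⊆ pathSet n x y := by
  rw [pathSet_comm n p y, pathSet_comm n x y]
  exact pathSet_left_subset (by rwa [pathSet_comm])

theorem pathSet_eq_union (h : p ∈ pathSet n x y) :
    pathSet n x y = pathSet n x p ∪ pathSet n p y :=
  (pathSet_subset_union n x y p).antisymm
    (Set.union_subset (pathSet_left_subset h) (pathSet_right_subset h))

/-- The points of a path are linearly ordered. -/
theorem eq_of_mem_pathSet_of_mem_pathSet (hj : JoinedIn (VS n) x p) (hq : q ∈ pathSet n x p)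
    (hp : p ∈ pathSet n x q) : p = q := by
  by_contra hpq
  obtain ⟨γ, hγ⟩ := hj
  -- Whichever of p, q the curve meets first is reached while avoiding the other, which contradicts
  -- one of the two memberships.
  obtain ⟨z, hz, -, hj⟩ := γ.exists_first_hit (S := VS n) (C := {p, q})
    (by rintro _ ⟨t, rfl⟩; exact hγ t) (Set.toFinite _).isClosed (by simp)
  have hV : z ∈ VS n := by
    by_contra hzV
    have hpV : p ∈ VS n := by simpa using hγ 1
    obtain ⟨δ, hδ⟩ := hj
    have hqV : q ∈ VS n := by
      obtain ⟨t, rfl⟩ := hq γ (by rintro _ ⟨t, rfl⟩; exact hγ t)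
      exact hγ t
    rcases hz with rfl | rfl <;> contradiction
  rcases hz with rfl | rfl
  · refine notMem_pathSet_iff.2 (hj.mono ?_) hq
    rintro a (⟨ha, hb⟩ | rfl)
    · exact ⟨ha, fun e => hb (by simp_all)⟩
    · exact ⟨hV, hpq⟩
  · refine notMem_pathSet_iff.2 (hj.mono ?_) hp
    rintro a (⟨ha, hb⟩ | rfl)
    · exact ⟨ha, fun e => hb (by simp_all)⟩
    · exact ⟨hV, fun e => hpq e.symm⟩

/-- If the two halves shared another point q, the linear order on each half would let one go from x
to q and from q to y without meeting p. -/
theorem pathSet_inter_eq (hxp : JoinedIn (VS n) x p) (hyp : JoinedIn (VS n) y p)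
    (h : p ∈ pathSet n x y) : pathSet n x p ∩ pathSet n p y = {p} := by
  refine Set.Subset.antisymm ?_ ?_
  · rintro q ⟨h1, h2⟩
    by_contra hpq
    have hpq : p ≠ q := fun e => hpq e.symm
    have ha : p ∉ pathSet n x q := fun h' => hpq (eq_of_mem_pathSet_of_mem_pathSet hxp h1 h')
    have hb : p ∉ pathSet n y q := fun h' =>
      hpq (eq_of_mem_pathSet_of_mem_pathSet hyp (by rwa [pathSet_comm]) h')
    rcases pathSet_subset_union n x y q h with h' | h'
    · exact ha h'
    · exact hb (by rwa [pathSet_comm])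
  · rintro _ rfl
    exact ⟨right_mem_pathSet n _ _, left_mem_pathSet n _ _⟩

end Vicsek

end

noncomputable section
namespace Vicsek
variable {n : ℕ} {x y z p q : ℂ}

/-! ## The similarities and their cells -/

/-- The contraction ratio of the similarities. -/
def ratio (n : ℕ) : ℝ := (2 * (n : ℝ) - 1)⁻¹

theorem three_le (hn : 2 ≤ n) : (3 : ℝ) ≤ 2 * (n : ℝ) - 1 := by
  have : (2 : ℝ) ≤ n := by exact_mod_cast hn
  linarith

theorem mul_ratio (hn : 2 ≤ n) : (2 * (n : ℝ) - 1) * ratio n = 1 :=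
  mul_inv_cancel₀ (by linarith [three_le hn])

theorem ratio_pos (hn : 2 ≤ n) : 0 < ratio n := inv_pos.2 (by linarith [three_le hn])

theorem ratio_le (hn : 2 ≤ n) : ratio n ≤ 1 / 3 := by
  rw [ratio, inv_eq_one_div]
  exact one_div_le_one_div_of_le (by norm_num) (three_le hn)

theorem F_eq (i : Idx n) (z : ℂ) : F n i z = cellCenter n i + (ratio n : ℂ) * z := by
  simp only [F, ratio]; push_cast; ring

theorem cellCenter_inr (j : Fin 4) (k : Fin (n - 1)) :
    cellCenter n (Sum.inr (j, k)) = ((2 * ((k : ℕ) + 1) * ratio n : ℝ) : ℂ) * corner j := by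
  simp only [cellCenter, ratio]; push_cast; ring

theorem ratio_ne_zero (hn : 2 ≤ n) : (ratio n : ℂ) ≠ 0 := by
  exact_mod_cast (ratio_pos hn).ne'

theorem F_injective (hn : 2 ≤ n) (i : Idx n) : Function.Injective (F n i) := fun x y h => by
  simpa [F_eq, ratio_ne_zero hn] using h

theorem F_surjective (hn : 2 ≤ n) (i : Idx n) : Function.Surjective (F n i) := fun y =>
  ⟨(y - cellCenter n i) / ratio n, by rw [F_eq, mul_div_cancel₀ _ (ratio_ne_zero hn)]; ring⟩

theorem F_continuous (i : Idx n) : Continuous (F n i) := by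
  unfold F; fun_prop

theorem corner_add_two (j : Fin 4) : corner (j + 2) = -corner j := by
  fin_cases j <;> simp [corner, pow_succ]

/-- The coordinate along the arm ending in `corner j`. -/
def coord (j : Fin 4) (z : ℂ) : ℝ := ((starRingEnd ℂ) (corner j) * z).re

theorem coord_add (j : Fin 4) (z w : ℂ) : coord j (z + w) = coord j z + coord j w := by
  simp [coord, mul_add]

theorem coord_sub (j : Fin 4) (z w : ℂ) : coord j (z - w) = coord j z - coord j w := by
  simp [coord, mul_sub]

theorem coord_mul (j : Fin 4) (t : ℝ) (z : ℂ) : coord j ((t : ℂ) * z) = t * coord j z := by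
  simp only [coord, Complex.mul_re, Complex.ofReal_re, Complex.ofReal_im, Complex.mul_im]; ring

theorem coord_add_two (j : Fin 4) (z : ℂ) : coord (j + 2) z = -coord j z := by
  simp [coord, corner_add_two]

theorem coord_corner_self (j : Fin 4) : coord j (corner j) = 1 := by
  fin_cases j <;> simp [coord, corner, pow_succ]

theorem coord_corner_nonpos {j k : Fin 4} (h : k ≠ j) : coord j (corner k) ≤ 0 := by
  fin_cases j <;> fin_cases k <;> simp [coord, corner, pow_succ] at h ⊢

/-- The square spanned by the four corners. -/
def diamond : Set ℂ := {z | |z.re| + |z.im| ≤ 1}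

theorem corner_mem_diamond (j : Fin 4) : corner j ∈ diamond := by
  fin_cases j <;> simp [diamond, corner, pow_succ]

theorem coord_le_one (j : Fin 4) (h : z ∈ diamond) : coord j z ≤ 1 := by
  have h : |z.re| + |z.im| ≤ 1 := h
  have h1 := abs_le.1 (le_refl |z.re|)
  have h2 := abs_le.1 (le_refl |z.im|)
  have h3 := abs_nonneg z.re
  have h4 := abs_nonneg z.im
  fin_cases j <;> simp [coord, corner, pow_succ] <;> linarith

theorem neg_one_le_coord (j : Fin 4) (h : z ∈ diamond) : -1 ≤ coord j z := by
  have := coord_le_one (j + 2) h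
  rw [coord_add_two] at this
  linarith

theorem eq_corner_of_one_le_coord {j : Fin 4} (h : z ∈ diamond) (hc : 1 ≤ coord j z) :
    z = corner j := by
  have h : |z.re| + |z.im| ≤ 1 := h
  have h1 := abs_le.1 (le_refl |z.re|)
  have h2 := abs_le.1 (le_refl |z.im|)
  have h3 := abs_nonneg z.re
  have h4 := abs_nonneg z.im
  fin_cases j <;> simp [coord, corner, pow_succ] at hc ⊢ <;> apply Complex.ext <;> simp <;> linarith

theorem norm_le_one_of_mem_diamond (h : z ∈ diamond) : ‖z‖ ≤ 1 :=
  (Complex.norm_le_abs_re_add_abs_im z).trans h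

theorem isClosed_diamond : IsClosed diamond :=
  isClosed_le (by fun_prop) continuous_const

theorem F_mem_diamond (hn : 2 ≤ n) (i : Idx n) (hz : z ∈ diamond) : F n i z ∈ diamond := by
  have hr := ratio_pos hn
  have hz : |z.re| + |z.im| ≤ 1 := hz
  have key : ∀ c : ℂ, |c.re| + |c.im| ≤ 1 - ratio n →
      |(c + (ratio n : ℂ) * z).re| + |(c + (ratio n : ℂ) * z).im| ≤ 1 := by
    intro c hc
    have h1 := abs_add_le c.re (ratio n * z.re)
    have h2 := abs_add_le c.im (ratio n * z.im)
    rw [abs_mul, abs_of_pos hr] at h1 h2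
    simp only [Complex.add_re, Complex.add_im, Complex.re_ofReal_mul, Complex.im_ofReal_mul]
    nlinarith
  show |(F n i z).re| + |(F n i z).im| ≤ 1
  rw [F_eq]
  apply key
  rcases i with _ | ⟨j, k⟩
  · simp [cellCenter]; linarith [ratio_le hn]
  · rw [cellCenter_inr]
    have hk : ((k : ℕ) : ℝ) + 1 ≤ n - 1 := by
      have := k.2
      have h2 : (k : ℕ) + 2 ≤ n := by omega
      have : (((k : ℕ) + 2 : ℕ) : ℝ) ≤ n := by exact_mod_cast h2
      push_cast at this; linarith
    have hk0 : (0 : ℝ) ≤ 2 * (((k : ℕ) : ℝ) + 1) * ratio n := by positivity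
    have hj : |(corner j).re| + |(corner j).im| ≤ 1 := corner_mem_diamond j
    rw [Complex.re_ofReal_mul, Complex.im_ofReal_mul, abs_mul (_ * ratio n), abs_mul (_ * ratio n),
      abs_of_nonneg hk0]
    have := mul_ratio hn
    have h3 := abs_nonneg (corner j).re
    have h4 := abs_nonneg (corner j).im
    nlinarith

/-- For `i ≠ k`, the cell `k` is seen from the cell `i` through the corner `exitCorner i k`
of the cell `i`. -/
def exitCorner : Idx n → Idx n → Fin 4
  -- Junk value: here the two labels coincide.
  | Sum.inl _, Sum.inl _ => 0
  | Sum.inl _, Sum.inr (j, _) => j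
  | Sum.inr (j, _), Sum.inl _ => j + 2
  | Sum.inr (j, a), Sum.inr (k, b) => if k = j ∧ a < b then j else j + 2

/-- Distinct centres are at least two cell radii apart in the direction of the exit corner. All
separation statements about cells are linear consequences of this inequality. -/
theorem two_mul_ratio_le_coord (hn : 2 ≤ n) {i k : Idx n} (h : i ≠ k) :
    2 * ratio n ≤ coord (exitCorner i k) (cellCenter n k - cellCenter n i) := by
  have hr := ratio_pos hn
  rcases i with _ | ⟨j, a⟩ <;> rcases k with _ | ⟨l, b⟩
  · exact absurd rfl h
  · rw [cellCenter_inr, cellCenter, sub_zero, coord_mul]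
    simp only [exitCorner, coord_corner_self]
    have : (0 : ℝ) ≤ (b : ℕ) := by positivity
    nlinarith
  · rw [cellCenter_inr, cellCenter, zero_sub, ← neg_mul, ← Complex.ofReal_neg, coord_mul]
    simp only [exitCorner, coord_add_two, coord_corner_self]
    have : (0 : ℝ) ≤ (a : ℕ) := by positivity
    nlinarith
  · rw [cellCenter_inr, cellCenter_inr, coord_sub, coord_mul, coord_mul]
    by_cases hl : l = j
    · subst hl
      by_cases hab : a < b
      · have : ((a : ℕ) : ℝ) + 1 ≤ (b : ℕ) := by exact_mod_cast hab
        simp only [exitCorner, hab, and_self, if_true, coord_corner_self]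
        nlinarith
      · have hba : b < a := lt_of_le_of_ne (not_lt.1 hab) (by rintro rfl; exact h rfl)
        have : ((b : ℕ) : ℝ) + 1 ≤ (a : ℕ) := by exact_mod_cast hba
        simp only [exitCorner, hab, and_false, if_false, coord_add_two, coord_corner_self]
        nlinarith
    · simp only [exitCorner, hl, false_and, if_false, coord_add_two, coord_corner_self]
      have h1 := coord_corner_nonpos hl
      have h2 : (0 : ℝ) ≤ 2 * (((b : ℕ) : ℝ) + 1) * ratio n := by positivity
      have h3 : (0 : ℝ) ≤ (a : ℕ) := by positivity
      nlinarith

/-- Distinct cells meet at most in a corner. -/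
theorem eq_exitCorner (hn : 2 ≤ n) {i k : Idx n} (h : i ≠ k) (hx : x ∈ diamond) (hy : y ∈ diamond)
    (e : F n i x = F n k y) : x = corner (exitCorner i k) := by
  apply eq_corner_of_one_le_coord hx
  have hr := ratio_pos hn
  have h1 := two_mul_ratio_le_coord hn h
  have h2 := neg_one_le_coord (exitCorner i k) hy
  have h3 := congrArg (coord (exitCorner i k)) e
  rw [F_eq, F_eq, coord_add, coord_add, coord_mul, coord_mul] at h3
  rw [coord_sub] at h1
  nlinarith

theorem ratio_le_coord (hn : 2 ≤ n) {i k : Idx n} (h : i ≠ k) (hx : x ∈ diamond) :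
    ratio n ≤ coord (exitCorner i k) (F n k x - cellCenter n i) := by
  have h1 := two_mul_ratio_le_coord hn h
  have h2 := neg_one_le_coord (exitCorner i k) hx
  have hr := ratio_pos hn
  rw [coord_sub] at h1
  rw [coord_sub, F_eq, coord_add, coord_mul]
  nlinarith

/-- Cells that touch each other are seen from a third cell through the same corner. From the central
cell, cells on different arms could only touch at their inner corners, which are distinct; from a
cell on an arm the two candidate directions are opposite, and the common point cannot have a
positive coordinate in both. This makes the retraction well defined. -/
theorem exitCorner_congr (hn : 2 ≤ n) {i k l : Idx n} (hk : i ≠ k) (hl : i ≠ l)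
    (hx : x ∈ diamond) (hy : y ∈ diamond) (e : F n k x = F n l y) :
    exitCorner i k = exitCorner i l := by
  have hr := ratio_pos hn
  rcases i with _ | ⟨j, a⟩
  · rcases k with _ | ⟨j, a⟩
    · exact absurd rfl hk
    rcases l with _ | ⟨m, b⟩
    · exact absurd rfl hl
    by_contra hjm
    have hjm : m ≠ j := fun h => hjm h.symm
    have hne : (Sum.inr (j, a) : Idx n) ≠ Sum.inr (m, b) := by
      intro h; simp only [Sum.inr.injEq, Prod.mk.injEq] at h; exact hjm h.1.symm
    have h1 := eq_exitCorner hn hne hx hy e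
    have h2 := eq_exitCorner hn hne.symm hy hx e.symm
    simp only [exitCorner, hjm, hjm.symm, false_and, if_false, corner_add_two] at h1 h2
    have h3 := congrArg (coord j) e
    rw [F_eq, F_eq, h1, h2, cellCenter_inr, cellCenter_inr, mul_neg, mul_neg, ← sub_eq_add_neg,
      ← sub_eq_add_neg, ← sub_mul, ← sub_mul, ← Complex.ofReal_sub, ← Complex.ofReal_sub,
      coord_mul, coord_mul, coord_corner_self] at h3
    have h4 := coord_corner_nonpos hjm
    have h5 : (0 : ℝ) ≤ 2 * ((b : ℕ) + 1) * ratio n - ratio n := by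
      have : (0 : ℝ) ≤ (b : ℕ) := by positivity
      nlinarith
    have h6 : (0 : ℝ) < 2 * ((a : ℕ) + 1) * ratio n - ratio n := by
      have : (0 : ℝ) ≤ (a : ℕ) := by positivity
      nlinarith
    nlinarith
  · have key : ∀ k : Idx n, exitCorner (Sum.inr (j, a)) k = j ∨
        exitCorner (Sum.inr (j, a)) k = j + 2 := by
      rintro (_ | ⟨m, b⟩)
      · exact Or.inr rfl
      · simp only [exitCorner]; split_ifs <;> simp
    have h1 := ratio_le_coord hn hk hx
    have h2 := ratio_le_coord hn hl hy
    rw [e] at h1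
    rcases key k with hk | hk <;> rcases key l with hl | hl <;> rw [hk, hl] <;>
      rw [hk] at h1 <;> rw [hl] at h2 <;> rw [coord_add_two] at * <;> linarith

/-! ## The Vicsek set is self-similar -/

theorem wordMap_cons {m : ℕ} (i : Idx n) (w : Fin m → Idx n) (z : ℂ) :
    wordMap n (Fin.cons i w : Fin (m + 1) → Idx n) z = F n i (wordMap n w z) := by
  simp [wordMap]

theorem wordMap_zero (w : Fin 0 → Idx n) (z : ℂ) : wordMap n w z = z := by
  simp [wordMap]

theorem vertices_zero : vertices n 0 = Set.range corner := by
  ext z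
  constructor
  · rintro ⟨w, j, rfl⟩; exact ⟨j, (wordMap_zero w _).symm⟩
  · rintro ⟨j, rfl⟩; exact ⟨Fin.elim0, j, (wordMap_zero _ _).symm⟩

theorem vertices_succ (m : ℕ) : vertices n (m + 1) = ⋃ i, F n i '' vertices n m := by
  ext z
  simp only [Set.mem_iUnion]
  constructor
  · rintro ⟨w, j, rfl⟩
    refine ⟨w 0, wordMap n (Fin.tail w) (corner j), ⟨_, _, rfl⟩, ?_⟩
    rw [← wordMap_cons, Fin.cons_self_tail]
  · rintro ⟨i, _, ⟨w, j, rfl⟩, rfl⟩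
    exact ⟨Fin.cons i w, j, (wordMap_cons i w _).symm⟩

/-- The label of the outermost cell on an arm. -/
def lastIdx (hn : 2 ≤ n) (j : Fin 4) : Idx n := Sum.inr (j, ⟨n - 2, by omega⟩)

theorem F_lastIdx (hn : 2 ≤ n) (j : Fin 4) : F n (lastIdx hn j) (corner j) = corner j := by
  rw [F_eq, lastIdx, cellCenter_inr, ← add_mul, ← Complex.ofReal_add]
  have h : ((n - 2 : ℕ) : ℝ) = n - 2 := by rw [Nat.cast_sub hn]; norm_num
  have : 2 * (((n - 2 : ℕ) : ℝ) + 1) * ratio n + ratio n = 1 := by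
    rw [h]; linear_combination mul_ratio hn
  simp only [this, Complex.ofReal_one, one_mul]

/-- Each corner is fixed by the outermost similarity of its arm, so the vertices of all levels form
a set that equals the union of its own images. Closure commutes with finite unions, and with
continuous images because the set is bounded. -/
theorem VS_eq_iUnion (hn : 2 ≤ n) : VS n = ⋃ i, F n i '' VS n := by
  have hU : (⋃ m, vertices n m) = ⋃ i, F n i '' ⋃ m, vertices n m := by
    ext z
    simp only [Set.mem_iUnion, Set.mem_image]
    constructor
    · rintro ⟨m, hm⟩
      rcases m with _ | m
      · rw [vertices_zero] at hm
        obtain ⟨j, rfl⟩ := hm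
        exact ⟨lastIdx hn j, corner j, ⟨0, by rw [vertices_zero]; exact ⟨j, rfl⟩⟩, F_lastIdx hn j⟩
      · rw [vertices_succ] at hm
        obtain ⟨i, y, hy, rfl⟩ := Set.mem_iUnion.1 hm
        exact ⟨i, y, ⟨m, hy⟩, rfl⟩
    · rintro ⟨i, y, ⟨m, hm⟩, rfl⟩
      exact ⟨m + 1, by rw [vertices_succ]; exact Set.mem_iUnion.2 ⟨i, y, hm, rfl⟩⟩
  have hsub : (⋃ m, vertices n m) ⊆ diamond := by
    refine Set.iUnion_subset fun m => ?_
    induction m with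
    | zero => rw [vertices_zero]; rintro _ ⟨j, rfl⟩; exact corner_mem_diamond j
    | succ m ih =>
      rw [vertices_succ]
      refine Set.iUnion_subset fun i => ?_
      rintro _ ⟨y, hy, rfl⟩
      exact F_mem_diamond hn i (ih hy)
  have hb : Bornology.IsBounded (⋃ m, vertices n m) :=
    (Metric.isBounded_closedBall (x := (0 : ℂ)) (r := 1)).subset fun z hz => by
      simpa using norm_le_one_of_mem_diamond (hsub hz)
  unfold VS
  conv_lhs => rw [hU]
  rw [closure_iUnion_of_finite]
  refine Set.iUnion_congr fun i => ?_
  exact (image_closure_of_isCompact hb.isCompact_closure (F_continuous i).continuousOn).symm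

theorem VS_subset_diamond (hn : 2 ≤ n) : VS n ⊆ diamond := by
  refine closure_minimal (Set.iUnion_subset fun m => ?_) isClosed_diamond
  induction m with
  | zero => rw [vertices_zero]; rintro _ ⟨j, rfl⟩; exact corner_mem_diamond j
  | succ m ih =>
    rw [vertices_succ]
    refine Set.iUnion_subset fun i => ?_
    rintro _ ⟨y, hy, rfl⟩
    exact F_mem_diamond hn i (ih hy)

theorem isClosed_VS : IsClosed (VS n) := isClosed_closure

theorem isCompact_VS (hn : 2 ≤ n) : IsCompact (VS n) :=
  Metric.isCompact_of_isClosed_isBounded isClosed_VS <|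
    (Metric.isBounded_closedBall (x := (0 : ℂ)) (r := 1)).subset fun z hz => by
      simpa using norm_le_one_of_mem_diamond (VS_subset_diamond hn hz)

theorem F_mem_VS (hn : 2 ≤ n) (i : Idx n) (hz : z ∈ VS n) : F n i z ∈ VS n := by
  rw [VS_eq_iUnion hn]
  exact Set.mem_iUnion.2 ⟨i, z, hz, rfl⟩

theorem exists_cell (hn : 2 ≤ n) (hz : z ∈ VS n) : ∃ i, ∃ y ∈ VS n, F n i y = z := by
  rw [VS_eq_iUnion hn] at hz
  simpa using hz

theorem corner_mem_VS (j : Fin 4) : corner j ∈ VS n :=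
  subset_closure (Set.mem_iUnion.2 ⟨0, by rw [vertices_zero]; exact ⟨j, rfl⟩⟩)

theorem norm_le_one (hn : 2 ≤ n) (hz : z ∈ VS n) : ‖z‖ ≤ 1 :=
  norm_le_one_of_mem_diamond (VS_subset_diamond hn hz)

theorem wordMap_mem_VS (hn : 2 ≤ n) {m : ℕ} (w : Fin m → Idx n) (hz : z ∈ VS n) :
    wordMap n w z ∈ VS n := by
  induction m with
  | zero => rwa [wordMap_zero]
  | succ m ih =>
    rw [← Fin.cons_self_tail w, wordMap_cons]
    exact F_mem_VS hn _ (ih _)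

/-! ## Retraction onto a cell -/

open Classical in
/-- The retraction of the Vicsek set onto the cell `i`, followed by the inverse of `F n i`. -/
def retract (n : ℕ) (i : Idx n) (y : ℂ) : ℂ :=
  if h : ∃ x ∈ VS n, F n i x = y then h.choose
  else if h : ∃ k, ∃ x ∈ VS n, F n k x = y then corner (exitCorner i h.choose) else 0

theorem retract_F (hn : 2 ≤ n) (i : Idx n) (hx : x ∈ VS n) : retract n i (F n i x) = x := by
  have h : ∃ y ∈ VS n, F n i y = F n i x := ⟨x, hx, rfl⟩
  rw [retract, dif_pos h]
  exact F_injective hn i h.choose_spec.2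

/-- The choices in `retract` are ambiguous at points lying in several cells. A point shared with the
cell i must be the exit corner, and otherwise `exitCorner_congr` removes the dependence on the
chosen cell. -/
theorem retract_F_of_ne (hn : 2 ≤ n) {i k : Idx n} (hik : i ≠ k) (hx : x ∈ VS n) :
    retract n i (F n k x) = corner (exitCorner i k) := by
  have hD := VS_subset_diamond hn
  by_cases h : ∃ y ∈ VS n, F n i y = F n k x
  · obtain ⟨y, hy, e⟩ := h
    rw [← e, retract_F hn i hy]
    exact eq_exitCorner hn hik (hD hy) (hD hx) e
  · have h' : ∃ k', ∃ y ∈ VS n, F n k' y = F n k x := ⟨k, x, hx, rfl⟩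
    rw [retract, dif_neg h, dif_pos h']
    have hs := h'.choose_spec
    obtain ⟨y, hy, e⟩ := hs
    by_cases hk : h'.choose = k
    · rw [hk]
    · have hi : i ≠ h'.choose := by
        intro hi
        exact h ⟨y, hy, by rw [← e, hi]⟩
      rw [exitCorner_congr hn hi hik (hD hy) (hD hx) e]

theorem retract_cases (hn : 2 ≤ n) (i : Idx n) (hy : y ∈ VS n) :
    (∃ x ∈ VS n, F n i x = y ∧ retract n i y = x) ∨
      y ∉ F n i '' VS n ∧ ∃ j, retract n i y = corner j := by
  obtain ⟨k, x, hx, rfl⟩ := exists_cell hn hy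
  by_cases h : F n k x ∈ F n i '' VS n
  · obtain ⟨x', hx', e⟩ := h
    exact Or.inl ⟨x', hx', e, by rw [← e, retract_F hn i hx']⟩
  · refine Or.inr ⟨h, exitCorner i k, retract_F_of_ne hn ?_ hx⟩
    rintro rfl
    exact h ⟨x, hx, rfl⟩

theorem retract_mem (hn : 2 ≤ n) (i : Idx n) (hy : y ∈ VS n) : retract n i y ∈ VS n := by
  rcases retract_cases hn i hy with ⟨x, hx, -, h⟩ | ⟨-, j, h⟩
  · rwa [h]
  · rw [h]; exact corner_mem_VS j

theorem retract_corner (hn : 2 ≤ n) (i : Idx n) (j : Fin 4) :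
    ∃ k, retract n i (corner j) = corner k := by
  conv in retract n i _ => rw [← F_lastIdx hn j]
  by_cases h : i = lastIdx hn j
  · exact ⟨j, by rw [h, retract_F hn _ (corner_mem_VS j)]⟩
  · exact ⟨_, retract_F_of_ne hn h (corner_mem_VS j)⟩

/-- The cells form a finite closed cover, and on each of them the map is an inverse similarity or a
constant. -/
theorem retract_continuousOn (hn : 2 ≤ n) (i : Idx n) : ContinuousOn (retract n i) (VS n) := by
  conv => arg 2; rw [VS_eq_iUnion hn]
  refine (locallyFinite_of_finite _).continuousOn_iUnion (fun k => ?_) (fun k => ?_)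
  · exact ((isCompact_VS hn).image (F_continuous k)).isClosed
  · by_cases h : i = k
    · subst h
      have : ContinuousOn (fun y => (y - cellCenter n i) / ratio n) (F n i '' VS n) := by fun_prop
      refine this.congr ?_
      rintro _ ⟨x, hx, rfl⟩
      rw [retract_F hn i hx, F_eq]
      dsimp only
      rw [add_sub_cancel_left, mul_div_cancel_left₀ _ (ratio_ne_zero hn)]
    · refine (continuousOn_const (c := corner (exitCorner i k))).congr ?_
      rintro _ ⟨x, hx, rfl⟩
      exact retract_F_of_ne hn h hx

end Vicsek

end

/-! ### Connected finite sets and infinite polygons -/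

theorem IsPreconnected.subsingleton_of_finite {X : Type*} [TopologicalSpace X] [T1Space X]
    {s : Set X} (h : IsPreconnected s) (hs : s.Finite) : s.Subsingleton := by
  by_contra hc
  exact h.infinite_of_nontrivial (Set.not_subsingleton_iff.1 hc) hs

/-- An infinite polygonal curve of finite length reaches its limit point. -/
theorem joinedIn_polygon {E : Type*} [NormedAddCommGroup E] [NormedSpace ℝ E] [CompleteSpace E]
    {b : ℕ → E} {u : ℕ → ℝ} (hu : Summable u) (hb : ∀ k, ‖b k‖ ≤ u k) :
    JoinedIn ({∑' k, b k} ∪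
      ⋃ m, segment ℝ (∑ k ∈ Finset.range m, b k) (∑ k ∈ Finset.range (m + 1), b k)) 0 (∑' k, b k) := by
  -- The curve runs backwards from the limit point at s = 0. The k-th edge is fully present for s ≤
  -- 2^(-k-1), absent for s ≥ 2^(-k) and retracted linearly in between, so for s > 0 at most one
  -- edge is partially drawn.
  set ψ : ℕ → ℝ → ℝ := fun k s => max 0 (min 1 (2 - 2 ^ (k + 1) * s)) with hψ
  have hψ0 : ∀ k s, 0 ≤ ψ k s := fun k s => le_max_left _ _
  have hψ1 : ∀ k s, ψ k s ≤ 1 := fun k s => max_le zero_le_one (min_le_left _ _)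
  set f : ℝ → E := fun s => ∑' k, ψ k s • b k with hf
  have hfc : Continuous f := by
    refine continuous_tsum (u := u) (fun k => ?_) hu (fun k s => ?_)
    · simp only [hψ]; fun_prop
    · rw [norm_smul, Real.norm_of_nonneg (hψ0 k s)]
      exact (mul_le_of_le_one_left (norm_nonneg _) (hψ1 k s)).trans (hb k)
  have hone : ∀ {k s}, 2 ^ (k + 1) * s ≤ 1 → ψ k s = 1 := fun {k s} h => by
    simp only [hψ]; rw [min_eq_left (by linarith)]; simp
  have hzero : ∀ {k s}, 2 ≤ 2 ^ (k + 1) * s → ψ k s = 0 := fun {k s} h => by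
    simp only [hψ]; exact max_eq_left ((min_le_right _ _).trans (by linarith))
  have hf0 : f 0 = ∑' k, b k := tsum_congr fun k => by rw [hone (by simp)]; simp
  have hf1 : f 1 = 0 := by
    have : ∀ k, ψ k 1 • b k = 0 := fun k => by
      rw [hzero, zero_smul]
      rw [mul_one, pow_succ]; nlinarith [one_le_pow₀ (n := k) (one_le_two (α := ℝ))]
    simp only [hf, this, tsum_zero]
  have hp : IsPathConnected (f '' Set.Icc 0 1) :=
    ((convex_Icc (0 : ℝ) 1).isPathConnected ⟨0, by simp⟩).image hfc
  refine (hp.joinedIn 0 ⟨1, by simp, hf1⟩ _ ⟨0, by simp, hf0⟩).mono ?_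
  rintro _ ⟨s, ⟨hs0, hs1⟩, rfl⟩
  rcases hs0.eq_or_lt with rfl | hs0
  · exact Or.inl hf0
  right
  have hex : ∃ m : ℕ, 1 < 2 ^ (m + 1) * s := by
    obtain ⟨m, hm⟩ := pow_unbounded_of_one_lt (1 / s) (one_lt_two (α := ℝ))
    refine ⟨m, ?_⟩
    rw [div_lt_iff₀ hs0] at hm
    rw [pow_succ]; nlinarith
  classical
  set m := Nat.find hex
  have hm : 1 < 2 ^ (m + 1) * s := Nat.find_spec hex
  have hlt : ∀ k < m, ψ k s = 1 := fun k hk => hone (not_lt.1 (Nat.find_min hex hk))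
  have hgt : ∀ k, m < k → ψ k s = 0 := fun k hk => by
    apply hzero
    have h1 : (2 : ℝ) ^ (m + 1 + 1) ≤ 2 ^ (k + 1) := pow_le_pow_right₀ one_le_two (by omega)
    rw [pow_succ] at h1
    nlinarith
  refine Set.mem_iUnion.2 ⟨m, ?_⟩
  have : f s = ∑ k ∈ Finset.range m, b k + ψ m s • b m := by
    simp only [hf]
    rw [tsum_eq_sum (s := Finset.range (m + 1)), Finset.sum_range_succ]
    · congr 1
      exact Finset.sum_congr rfl fun k hk => by rw [hlt k (Finset.mem_range.1 hk), one_smul]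
    · intro k hk
      rw [hgt k (by simpa using hk), zero_smul]
  rw [this, Finset.sum_range_succ, segment_eq_image']
  exact ⟨ψ m s, ⟨hψ0 _ _, hψ1 _ _⟩, by simp⟩

noncomputable section
namespace Vicsek
variable {n : ℕ} {x y z p q : ℂ}

/-! ## The diagonals -/

theorem norm_corner (j : Fin 4) : ‖corner j‖ = 1 := by simp [corner]

/-- The cell `i` lies on the diagonal through `corner j`. -/
def OnAxis (n : ℕ) (j : Fin 4) (i : Idx n) : Prop :=
  retract n i (corner j) = corner j ∧ retract n i (corner (j + 2)) = corner (j + 2)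

theorem add_two_add_two (j : Fin 4) : j + 2 + 2 = j := by fin_cases j <;> rfl

theorem add_two_ne (j : Fin 4) : j + 2 ≠ j := by fin_cases j <;> decide

theorem OnAxis.opp {j : Fin 4} {i : Idx n} (h : OnAxis n j i) : OnAxis n (j + 2) i :=
  ⟨h.2, by rw [add_two_add_two]; exact h.1⟩

theorem onAxis_inl (hn : 2 ≤ n) (j : Fin 4) (u : Unit) : OnAxis n j (Sum.inl u) := by
  have : ∀ k, retract n (Sum.inl u) (corner k) = corner k := fun k => by
    conv in retract n _ _ => rw [← F_lastIdx hn k]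
    exact retract_F_of_ne hn (by simp [lastIdx]) (corner_mem_VS k)
  exact ⟨this _, this _⟩

theorem onAxis_inr (hn : 2 ≤ n) (j : Fin 4) (a : Fin (n - 1)) : OnAxis n j (Sum.inr (j, a)) := by
  constructor
  · conv in retract n _ _ => rw [← F_lastIdx hn j]
    by_cases h : (Sum.inr (j, a) : Idx n) = lastIdx hn j
    · rw [h, retract_F hn _ (corner_mem_VS j)]
    · rw [retract_F_of_ne hn h (corner_mem_VS j)]
      have ha : (a : ℕ) < n - 2 := by
        refine lt_of_le_of_ne (by omega) fun e => h ?_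
        simp [lastIdx, Fin.ext_iff, e]
      have : a < ⟨n - 2, by omega⟩ := ha
      simp [exitCorner, lastIdx, this]
  · conv in retract n _ _ => rw [← F_lastIdx hn (j + 2)]
    have h : (Sum.inr (j, a) : Idx n) ≠ lastIdx hn (j + 2) := by
      intro h
      simp only [lastIdx, Sum.inr.injEq, Prod.mk.injEq] at h
      exact add_two_ne j h.1.symm
    rw [retract_F_of_ne hn h (corner_mem_VS _)]
    simp [exitCorner, lastIdx]

theorem exists_axis_cell_of_nonneg (hn : 2 ≤ n) (j : Fin 4) {s : ℝ} (h0 : 0 ≤ s) (h1 : s ≤ 1) :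
    ∃ i, OnAxis n j i ∧ ∃ t : ℝ, |t| ≤ 1 ∧ F n i (t * corner j) = s * corner j := by
  have hr := ratio_pos hn
  have hmr := mul_ratio hn
  by_cases hs : s ≤ ratio n
  · refine ⟨Sum.inl (), onAxis_inl hn j _, s / ratio n, ?_, ?_⟩
    · rw [abs_of_nonneg (by positivity), div_le_one hr]; exact hs
    · rw [F_eq, cellCenter, zero_add, Complex.ofReal_div, ← mul_assoc,
        mul_div_cancel₀ _ (ratio_ne_zero hn)]
  · push Not at hs
    -- Beyond the central cell, τ counts in units of one cell diameter; its ceiling numbers the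
    -- cells from 1, whereas the labels start at 0.
    set τ := (s / ratio n - 1) / 2 with hτ
    have hsτ : s = (2 * τ + 1) * ratio n := by rw [hτ]; field_simp; ring
    have hτ0 : 0 < τ := by
      by_contra hc; push Not at hc; nlinarith
    have hτn : τ ≤ n - 1 := by
      by_contra hc; push Not at hc; nlinarith
    have hc1 : τ ≤ ⌈τ⌉₊ := Nat.le_ceil τ
    have hc2 : (⌈τ⌉₊ : ℝ) < τ + 1 := Nat.ceil_lt_add_one hτ0.le
    have hc3 : 1 ≤ ⌈τ⌉₊ := Nat.one_le_iff_ne_zero.2 (Nat.ceil_pos.2 hτ0).ne'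
    have hc4 : ⌈τ⌉₊ ≤ n - 1 := by
      apply Nat.ceil_le.2
      rw [Nat.cast_sub (by omega)]; simpa using hτn
    refine ⟨Sum.inr (j, ⟨⌈τ⌉₊ - 1, by omega⟩), onAxis_inr hn j _, 2 * (τ - ⌈τ⌉₊) + 1, ?_, ?_⟩
    · rw [abs_le]; constructor <;> linarith
    · have h2 : ((⌈τ⌉₊ - 1 : ℕ) : ℝ) = ⌈τ⌉₊ - 1 := by rw [Nat.cast_sub hc3]; simp
      have h3 : 2 * (((⌈τ⌉₊ - 1 : ℕ) : ℝ) + 1) * ratio n + ratio n * (2 * (τ - ⌈τ⌉₊) + 1) = s := by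
        rw [h2]; linear_combination -hsτ
      rw [F_eq, cellCenter_inr, ← mul_assoc, ← add_mul]
      congr 1
      rw [← Complex.ofReal_mul, ← Complex.ofReal_add]
      exact congrArg Complex.ofReal h3

theorem exists_axis_cell (hn : 2 ≤ n) (j : Fin 4) {s : ℝ} (hs : |s| ≤ 1) :
    ∃ i, OnAxis n j i ∧ ∃ t : ℝ, |t| ≤ 1 ∧ F n i (t * corner j) = s * corner j := by
  rw [abs_le] at hs
  rcases le_total 0 s with h | h
  · exact exists_axis_cell_of_nonneg hn j h hs.2
  · obtain ⟨i, hi, t, ht, e⟩ := exists_axis_cell_of_nonneg hn (j + 2) (s := -s) (by linarith)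
      (by linarith)
    refine ⟨i, by simpa [add_two_add_two] using hi.opp, -t, by rwa [abs_neg], ?_⟩
    simpa [corner_add_two] using e

/-- A closed set which contains a corner and is stable under the similarities along a diagonal
contains that diagonal. -/
theorem axis_subset (hn : 2 ≤ n) {A : Set ℂ} (hA : IsClosed A) {j : Fin 4} (hj : corner j ∈ A)
    (hF : ∀ i, OnAxis n j i → ∀ z ∈ A, F n i z ∈ A) {s : ℝ} (hs : |s| ≤ 1) :
    (s : ℂ) * corner j ∈ A := by
  have hr := ratio_pos hn
  -- Pulling an axis point back through m axis cells, taking the corner there and pushing it forward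
  -- again gives a point of A at distance at most twice the size of an m-cell.
  have key : ∀ m : ℕ, ∀ s : ℝ, |s| ≤ 1 → ∃ b ∈ A, dist ((s : ℂ) * corner j) b ≤ 2 * ratio n ^ m := by
    intro m
    induction m with
    | zero =>
      intro s hs
      refine ⟨corner j, hj, ?_⟩
      have h1 : (s : ℂ) * corner j - corner j = ((s - 1 : ℝ) : ℂ) * corner j := by push_cast; ring
      rw [dist_eq_norm, h1, norm_mul, norm_corner, Complex.norm_real, Real.norm_eq_abs]
      rw [abs_le] at hs
      rw [pow_zero, mul_one, mul_one, abs_le]; constructor <;> linarith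
    | succ m ih =>
      intro s hs
      obtain ⟨i, hi, t, ht, e⟩ := exists_axis_cell hn j hs
      obtain ⟨b, hb, hd⟩ := ih t ht
      refine ⟨F n i b, hF i hi b hb, ?_⟩
      rw [dist_eq_norm] at hd
      rw [← e, F_eq, F_eq, dist_add_left, dist_eq_norm, ← mul_sub, norm_mul, Complex.norm_real,
        Real.norm_of_nonneg hr.le, pow_succ]
      nlinarith
  rw [← hA.closure_eq, Metric.mem_closure_iff]
  intro ε hε
  obtain ⟨m, hm⟩ := exists_pow_lt_of_lt_one (half_pos hε)
    ((ratio_le hn).trans_lt (by norm_num : (1 / 3 : ℝ) < 1))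
  obtain ⟨b, hb, hd⟩ := key m s hs
  exact ⟨b, hb, by linarith⟩

theorem axis_mem_VS (hn : 2 ≤ n) (j : Fin 4) {s : ℝ} (hs : |s| ≤ 1) :
    (s : ℂ) * corner j ∈ VS n :=
  axis_subset hn isClosed_VS (corner_mem_VS j) (fun i _ _ hz => F_mem_VS hn i hz) hs

theorem mem_halfDiagonal {j : Fin 4} : z ∈ halfDiagonal j ↔ ∃ t : ℝ, 0 ≤ t ∧ t ≤ 1 ∧ z = t * corner j := by
  rw [halfDiagonal, segment_eq_image']
  constructor
  · rintro ⟨t, ht, rfl⟩; exact ⟨t, ht.1, ht.2, by simp⟩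
  · rintro ⟨t, h0, h1, rfl⟩; exact ⟨t, ⟨h0, h1⟩, by simp⟩

theorem mem_diagonals : z ∈ diagonals ↔ ∃ j, ∃ t : ℝ, 0 ≤ t ∧ t ≤ 1 ∧ z = t * corner j := by
  simp [diagonals, mem_halfDiagonal]

theorem diagonals_subset_VS (hn : 2 ≤ n) : diagonals ⊆ VS n := by
  intro z hz
  obtain ⟨j, t, h0, h1, rfl⟩ := mem_diagonals.1 hz
  exact axis_mem_VS hn j (by rw [abs_le]; constructor <;> linarith)

theorem isClosed_diagonals : IsClosed diagonals := by
  refine isClosed_iUnion_of_finite fun j => ?_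
  rw [halfDiagonal, segment_eq_image']
  exact (isCompact_Icc.image (by fun_prop)).isClosed

theorem zero_mem_diagonals : (0 : ℂ) ∈ diagonals := mem_diagonals.2 ⟨0, 0, by simp⟩

theorem corner_mem_diagonals (j : Fin 4) : corner j ∈ diagonals := mem_diagonals.2 ⟨j, 1, by simp⟩

theorem zero_mem_VS (hn : 2 ≤ n) : (0 : ℂ) ∈ VS n := diagonals_subset_VS hn zero_mem_diagonals

theorem cellCenter_mem_diagonals (hn : 2 ≤ n) (i : Idx n) : cellCenter n i ∈ diagonals := by
  rcases i with _ | ⟨j, k⟩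
  · exact zero_mem_diagonals
  · rw [cellCenter_inr]
    have hr := ratio_pos hn
    have hk : ((k : ℕ) : ℝ) + 1 ≤ n - 1 := by
      have h2 : (k : ℕ) + 2 ≤ n := by omega
      have : (((k : ℕ) + 2 : ℕ) : ℝ) ≤ n := by exact_mod_cast h2
      push_cast at this; linarith
    exact mem_diagonals.2 ⟨j, _, by positivity, by nlinarith [mul_ratio hn], rfl⟩

theorem segment_zero_subset (hz : z ∈ diagonals) : segment ℝ 0 z ⊆ diagonals := by
  obtain ⟨j, t, h0, h1, rfl⟩ := mem_diagonals.1 hz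
  rw [segment_eq_image']
  rintro _ ⟨s, hs, rfl⟩
  refine mem_diagonals.2 ⟨j, s * t, mul_nonneg hs.1 h0, mul_le_one₀ hs.2 h0 h1, ?_⟩
  simp [mul_assoc]

/-! ## Connectedness -/

theorem exists_address (hn : 2 ≤ n) (hx : x ∈ VS n) : ∃ (i : ℕ → Idx n) (X : ℕ → ℂ), X 0 = x ∧
    ∀ m, X m ∈ VS n ∧ X m = F n (i m) (X (m + 1)) := by
  have : ∀ y : VS n, ∃ i, ∃ z : VS n, F n i z = y := fun ⟨y, hy⟩ => by
    obtain ⟨i, z, hz, e⟩ := exists_cell hn hy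
    exact ⟨i, ⟨z, hz⟩, e⟩
  choose g T hT using this
  refine ⟨fun m => g (T^[m] ⟨x, hx⟩), fun m => (T^[m] ⟨x, hx⟩ : VS n), rfl, fun m => ⟨Subtype.prop _, ?_⟩⟩
  simp only [Function.iterate_succ_apply', hT]

/-- Every point is joined to the centre by a curve of bounded length. -/
theorem exists_joinedIn_zero (hn : 2 ≤ n) (hx : x ∈ VS n) :
    ∃ A ⊆ VS n, JoinedIn A 0 x ∧ μH[1] A ≤ ENNReal.ofReal 2 := by
  obtain ⟨i, X, rfl, hX⟩ := exists_address hn hx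
  have hr := ratio_pos hn
  -- The partial sums of b are the centres of the nested cells containing x. Comparison with powers
  -- of 1/2 gives the total length bound 2.
  set b : ℕ → ℂ := fun k => (ratio n : ℂ) ^ k * cellCenter n (i k) with hb
  have hbu : ∀ k, ‖b k‖ ≤ (1 / 2 : ℝ) ^ k := by
    intro k
    rw [hb, norm_mul, norm_pow, Complex.norm_real, Real.norm_of_nonneg hr.le]
    refine (mul_le_of_le_one_right (by positivity)
      (norm_le_one hn (diagonals_subset_VS hn (cellCenter_mem_diagonals hn _)))).trans ?_
    exact pow_le_pow_left₀ hr.le ((ratio_le hn).trans (by norm_num)) k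
  have hsum : Summable fun k : ℕ => (1 / 2 : ℝ) ^ k := summable_geometric_two
  have hpart : ∀ m, X 0 = ∑ k ∈ Finset.range m, b k + (ratio n : ℂ) ^ m * X m := by
    intro m
    induction m with
    | zero => simp
    | succ m ih =>
      rw [ih, Finset.sum_range_succ, (hX m).2, F_eq, hb]; ring
  have hlim : ∑' k, b k = X 0 := by
    refine HasSum.tsum_eq ?_
    rw [(Summable.of_norm_bounded hsum hbu).hasSum_iff_tendsto_nat]
    have h1 : Tendsto (fun m => (ratio n : ℂ) ^ m * X m) atTop (𝓝 0) := by
      refine squeeze_zero_norm (a := fun m => (1 / 2 : ℝ) ^ m) (fun m => ?_)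
        (tendsto_pow_atTop_nhds_zero_of_lt_one (by norm_num) (by norm_num))
      rw [norm_mul, norm_pow, Complex.norm_real, Real.norm_of_nonneg hr.le]
      exact (mul_le_of_le_one_right (by positivity) (norm_le_one hn (hX m).1)).trans
        (pow_le_pow_left₀ hr.le ((ratio_le hn).trans (by norm_num)) m)
    have h2 : (fun m => ∑ k ∈ Finset.range m, b k) = fun m => X 0 - (ratio n : ℂ) ^ m * X m := by
      ext m; rw [hpart m]; ring
    rw [h2]
    simpa using tendsto_const_nhds.sub h1
  have hcell : ∀ m, ∀ p ∈ VS n, ∑ k ∈ Finset.range m, b k + (ratio n : ℂ) ^ m * p ∈ VS n := by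
    intro m
    induction m with
    | zero => intro p hp; simpa using hp
    | succ m ih =>
      intro p hp
      have := ih _ (F_mem_VS hn (i m) hp)
      rw [F_eq] at this
      rw [Finset.sum_range_succ, hb]
      convert this using 1
      ring
  have hj := joinedIn_polygon hsum hbu
  rw [hlim] at hj
  refine ⟨_, ?_, hj, ?_⟩
  · refine Set.union_subset (by simpa using (hX 0).1) (Set.iUnion_subset fun m => ?_)
    rw [segment_eq_image']
    rintro _ ⟨s, hs, rfl⟩
    have hp : s • cellCenter n (i m) ∈ VS n :=
      diagonals_subset_VS hn (segment_zero_subset (cellCenter_mem_diagonals hn (i m))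
        (by rw [segment_eq_image']; exact ⟨s, hs, by simp⟩))
    have := hcell m _ hp
    simp only [Finset.sum_range_succ, add_sub_cancel_left]
    rw [Complex.real_smul] at this ⊢
    convert this using 2
    simp only [hb]; ring
  · refine (measure_union_le _ _).trans ?_
    have h0 : μH[1] ({X 0} : Set ℂ) = 0 :=
      (Measure.nullSingletonClass_hausdorff ℂ one_pos).measure_singleton _
    rw [h0, zero_add]
    refine (measure_iUnion_le _).trans ?_
    simp only [hausdorffMeasure_segment, Finset.sum_range_succ]
    rw [← tsum_geometric_two, ENNReal.ofReal_tsum_of_nonneg (fun k => by positivity) hsum]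
    refine ENNReal.tsum_le_tsum fun k => ?_
    rw [edist_dist, dist_self_add_right]
    exact ENNReal.ofReal_le_ofReal (hbu k)

theorem joinedIn_VS (hn : 2 ≤ n) (hx : x ∈ VS n) (hy : y ∈ VS n) : JoinedIn (VS n) x y := by
  obtain ⟨A, hA, h1, -⟩ := exists_joinedIn_zero hn hx
  obtain ⟨B, hB, h2, -⟩ := exists_joinedIn_zero hn hy
  exact (h1.mono hA).symm.trans (h2.mono hB)

theorem pathSet_subset_VS (hn : 2 ≤ n) (hx : x ∈ VS n) (hy : y ∈ VS n) : pathSet n x y ⊆ VS n :=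
  pathSet_subset_of_joinedIn subset_rfl (joinedIn_VS hn hx hy)

end Vicsek

end

theorem JoinedIn.eq_of_finite {X : Type*} [TopologicalSpace X] [T1Space X] {A : Set X} {a b : X}
    (h : JoinedIn A a b) (hA : A.Finite) : a = b := by
  obtain ⟨γ, hγ⟩ := h
  have hsub : Set.range γ ⊆ A := by rintro _ ⟨t, rfl⟩; exact hγ t
  exact (isPreconnected_range γ.continuous).subsingleton_of_finite (hA.subset hsub)
    ⟨0, by simp⟩ ⟨1, by simp⟩

noncomputable section
namespace Vicsek
variable {n : ℕ} {x y z p q : ℂ}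

/-! ## Paths and cells -/

theorem isClosed_cell (hn : 2 ≤ n) (i : Idx n) : IsClosed (F n i '' VS n) :=
  ((isCompact_VS hn).image (F_continuous i)).isClosed

/-- Outside the cell the retraction only takes corner values, so it is constant along any curve that
stays outside until a final entry point. -/
theorem finite_retract_image (hn : 2 ≤ n) (i : Idx n) (z : ℂ) :
    (retract n i '' (VS n \ F n i '' VS n ∪ {z})).Finite := by
  refine ((Set.finite_range corner).union (Set.finite_singleton (retract n i z))).subset ?_
  rintro _ ⟨p, ⟨hp, hpc⟩ | rfl, rfl⟩
  · rcases retract_cases hn i hp with ⟨x, hx', e, -⟩ | ⟨-, j, h⟩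
    · exact absurd ⟨x, hx', e⟩ hpc
    · exact Or.inl ⟨j, h.symm⟩
  · exact Or.inr rfl

/-- A path into a cell enters it at the retraction of its starting point. -/
theorem F_retract_mem_pathSet (hn : 2 ≤ n) {i : Idx n} (hy : y ∈ VS n)
    (h : x ∈ F n i '' VS n ∨ retract n i x ≠ retract n i y) :
    F n i (retract n i y) ∈ pathSet n x y := by
  rw [pathSet_comm]
  intro γ hγ
  by_cases hC : ∃ p ∈ Set.range γ, p ∈ F n i '' VS n
  · obtain ⟨p, hp, hpC⟩ := hC
    -- The curve is stopped at its first point in the cell. The retraction is constant up to there,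
    -- so the entry point is the image of the retracted starting point.
    obtain ⟨δ, hδ⟩ := γ.joinedIn_range hp
    obtain ⟨z, hzC, ⟨t, rfl⟩, hj⟩ := δ.exists_first_hit (S := VS n)
      (by rintro _ ⟨t, rfl⟩; exact hγ (hδ t)) (isClosed_cell hn i) hpC
    have hz : δ t ∈ VS n := hγ (hδ t)
    have hsub : VS n \ F n i '' VS n ∪ {δ t} ⊆ VS n :=
      Set.union_subset Set.sdiff_subset (by simpa using hz)
    have := (hj.map_continuousOn ((retract_continuousOn hn i).mono hsub)).eq_of_finite
      (finite_retract_image hn i _)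
    rw [this]
    obtain ⟨w, hw, e⟩ := hzC
    rw [← e, retract_F hn i hw, e]
    exact hδ t
  · push Not at hC
    exfalso
    rcases h with h | h
    · exact hC x ⟨1, by simp⟩ h
    · have hj : JoinedIn (VS n \ F n i '' VS n ∪ {y}) y x :=
        (γ.joinedIn_range ⟨1, by simp⟩).mono fun a ha => Or.inl ⟨hγ ha, hC a ha⟩
      have hsub : VS n \ F n i '' VS n ∪ {y} ⊆ VS n :=
        Set.union_subset Set.sdiff_subset (by simpa using hy)
      exact h ((hj.map_continuousOn ((retract_continuousOn hn i).mono hsub)).eq_of_finite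
        (finite_retract_image hn i _)).symm

/-- A curve between points of the cell may leave it. Its retraction is a curve joining the
preimages, hence meets q at the image of some point a of the original curve; and travelling from the
cell to a requires passing through the image of q. -/
theorem pathSet_F (hn : 2 ≤ n) (i : Idx n) (hx : x ∈ VS n) (hy : y ∈ VS n) :
    pathSet n (F n i x) (F n i y) = F n i '' pathSet n x y := by
  apply Set.Subset.antisymm
  · intro q hq
    obtain ⟨q, rfl⟩ := F_surjective hn i q
    refine ⟨q, ?_, rfl⟩
    by_contra h
    refine notMem_pathSet_iff.2 (((notMem_pathSet_iff.1 h).map_continuousOn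
      (F_continuous i).continuousOn).mono ?_) hq
    rintro _ ⟨a, ⟨ha, hb⟩, rfl⟩
    exact ⟨F_mem_VS hn i ha, fun e => hb (F_injective hn i e)⟩
  · rintro _ ⟨q, hq, rfl⟩ γ hγ
    by_contra hqγ
    have hj := (γ.joinedIn_range (z := F n i y) ⟨1, by simp⟩).map_continuousOn
      ((retract_continuousOn hn i).mono hγ)
    rw [retract_F hn i hx, retract_F hn i hy] at hj
    have hsub : retract n i '' Set.range γ ⊆ VS n := by
      rintro _ ⟨a, ha, rfl⟩; exact retract_mem hn i (hγ ha)
    obtain ⟨a, ha, rfl⟩ := pathSet_subset_of_joinedIn hsub hj hq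
    refine notMem_pathSet_iff.2 ((γ.joinedIn_range ha).mono ?_)
      (F_retract_mem_pathSet hn (i := i) (hγ ha) (Or.inl ⟨x, hx, rfl⟩))
    exact fun b hb => ⟨hγ hb, fun e => hqγ (e ▸ hb)⟩

/-! ## The path metric -/

theorem hausdorff_singleton (p : ℂ) : μH[1] ({p} : Set ℂ) = 0 :=
  (Measure.nullSingletonClass_hausdorff ℂ one_pos).measure_singleton _

theorem hausdorff_pathSet_le (hn : 2 ≤ n) (hx : x ∈ VS n) (hy : y ∈ VS n) :
    μH[1] (pathSet n x y) ≤ ENNReal.ofReal 4 := by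
  obtain ⟨A, hA, h1, h1'⟩ := exists_joinedIn_zero hn hx
  obtain ⟨B, hB, h2, h2'⟩ := exists_joinedIn_zero hn hy
  calc μH[1] (pathSet n x y) ≤ μH[1] (A ∪ B) :=
        measure_mono ((pathSet_subset_union n x y 0).trans (Set.union_subset_union
          (pathSet_subset_of_joinedIn hA h1.symm) (pathSet_subset_of_joinedIn hB h2)))
    _ ≤ μH[1] A + μH[1] B := measure_union_le _ _
    _ ≤ ENNReal.ofReal 2 + ENNReal.ofReal 2 := add_le_add h1' h2'
    _ = ENNReal.ofReal 4 := by rw [← ENNReal.ofReal_add] <;> norm_num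

theorem hausdorff_pathSet_ne_top (hn : 2 ≤ n) (hx : x ∈ VS n) (hy : y ∈ VS n) :
    μH[1] (pathSet n x y) ≠ ⊤ :=
  ((hausdorff_pathSet_le hn hx hy).trans_lt ENNReal.ofReal_lt_top).ne

theorem pathDist_nonneg (n : ℕ) (x y : ℂ) : 0 ≤ pathDist n x y := ENNReal.toReal_nonneg

theorem pathDist_le (hn : 2 ≤ n) (hx : x ∈ VS n) (hy : y ∈ VS n) : pathDist n x y ≤ 4 := by
  have := ENNReal.toReal_mono ENNReal.ofReal_ne_top (hausdorff_pathSet_le hn hx hy)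
  rwa [ENNReal.toReal_ofReal (by norm_num)] at this

theorem pathDist_comm (n : ℕ) (x y : ℂ) : pathDist n x y = pathDist n y x := by
  rw [pathDist, pathSet_comm, pathDist]

theorem pathDist_triangle (hn : 2 ≤ n) (hx : x ∈ VS n) (hy : y ∈ VS n) (hp : p ∈ VS n) :
    pathDist n x y ≤ pathDist n x p + pathDist n p y := by
  unfold pathDist
  rw [← ENNReal.toReal_add (hausdorff_pathSet_ne_top hn hx hp) (hausdorff_pathSet_ne_top hn hp hy)]
  exact ENNReal.toReal_mono (ENNReal.add_ne_top.2
    ⟨hausdorff_pathSet_ne_top hn hx hp, hausdorff_pathSet_ne_top hn hp hy⟩)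
    ((measure_mono (pathSet_subset_union n x y p)).trans (measure_union_le _ _))

/-- The two halves of the path meet only in p, a null set for length, and all lengths involved are
finite. -/
theorem pathDist_add (hn : 2 ≤ n) (hx : x ∈ VS n) (hy : y ∈ VS n) (hp : p ∈ pathSet n x y) :
    pathDist n x y = pathDist n x p + pathDist n p y := by
  have hpV := pathSet_subset_VS hn hx hy hp
  have h := measure_union_add_inter (μ := (μH[1] : Measure ℂ)) (pathSet n x p)
    (isClosed_pathSet n p y).measurableSet
  rw [pathSet_inter_eq (joinedIn_VS hn hx hpV) (joinedIn_VS hn hy hpV) hp, hausdorff_singleton,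
    add_zero, ← pathSet_eq_union hp] at h
  rw [pathDist, h, ENNReal.toReal_add (hausdorff_pathSet_ne_top hn hx hpV)
    (hausdorff_pathSet_ne_top hn hpV hy)]
  rfl

theorem pathDist_self (hn : 2 ≤ n) (hx : x ∈ VS n) : pathDist n x x = 0 := by
  have := pathDist_add hn hx hx (left_mem_pathSet n x x)
  linarith

open scoped Pointwise in
theorem pathDist_F (hn : 2 ≤ n) (i : Idx n) (hx : x ∈ VS n) (hy : y ∈ VS n) :
    pathDist n (F n i x) (F n i y) = ratio n * pathDist n x y := by
  have hr := ratio_pos hn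
  have : ∀ A : Set ℂ, μH[1] (F n i '' A) = ENNReal.ofReal (ratio n) * μH[1] A := by
    intro A
    have h1 : F n i '' A = (fun z => cellCenter n i + z) '' ((ratio n) • A) := by
      rw [← Set.image_smul, Set.image_image]
      refine Set.image_congr fun z _ => ?_
      rw [F_eq, Complex.real_smul]
    have h2 := (IsometryEquiv.addLeft (cellCenter n i)).isometry.hausdorffMeasure_image
      (d := 1) (Or.inl zero_le_one) ((ratio n) • A)
    rw [h1]
    refine h2.trans ?_
    rw [Measure.hausdorffMeasure_smul₀ zero_le_one hr.ne', NNReal.rpow_one, ENNReal.smul_def,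
      smul_eq_mul]
    congr 1
    rw [← enorm_eq_nnnorm, Real.enorm_eq_ofReal hr.le]
  rw [pathDist, pathSet_F hn i hx hy, this, ENNReal.toReal_mul, ENNReal.toReal_ofReal hr.le]
  rfl

/-- The last summand does not depend on x. Thus, up to a constant, the distance to y restricted to a
cell is a scaled distance function with pole at the retracted point. -/
theorem pathDist_F_left (hn : 2 ≤ n) (i : Idx n) (hx : x ∈ VS n) (hy : y ∈ VS n) :
    pathDist n (F n i x) y =
      ratio n * pathDist n x (retract n i y) + pathDist n (F n i (retract n i y)) y := by
  rw [pathDist_add hn (F_mem_VS hn i hx) hy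
    (F_retract_mem_pathSet hn hy (Or.inl ⟨x, hx, rfl⟩)),
    pathDist_F hn i hx (retract_mem hn i hy)]

/-! ## Paths along the diagonals -/

/-- The path between opposite corners crosses every cell of the axis between that cell's own
opposite corners, so it is stable under the similarities of the axis and `axis_subset` applies. -/
theorem segment_corners_subset (hn : 2 ≤ n) (j : Fin 4) {s : ℝ} (hs : |s| ≤ 1) :
    (s : ℂ) * corner j ∈ pathSet n (corner j) (corner (j + 2)) := by
  refine axis_subset hn (isClosed_pathSet n _ _) (left_mem_pathSet n _ _) (fun i hi z hz => ?_) hs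
  have hne : corner j ≠ corner (j + 2) := by
    intro h
    have := congrArg (coord j) h
    rw [corner_add_two, coord_corner_self, ← corner_add_two] at this
    linarith [coord_corner_nonpos (add_two_ne j)]
  have h1 := F_retract_mem_pathSet hn (i := i) (x := corner (j + 2)) (corner_mem_VS j)
    (Or.inr (by rw [hi.1, hi.2]; exact hne.symm))
  have h2 := F_retract_mem_pathSet hn (i := i) (x := corner j) (corner_mem_VS (j + 2))
    (Or.inr (by rw [hi.1, hi.2]; exact hne))
  rw [pathSet_comm, hi.1] at h1
  rw [hi.2] at h2
  have h3 : F n i z ∈ pathSet n (F n i (corner j)) (F n i (corner (j + 2))) := by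
    rw [pathSet_F hn i (corner_mem_VS _) (corner_mem_VS _)]; exact ⟨z, hz, rfl⟩
  rcases (pathSet_eq_union h1).subset h2 with h | h
  · have h4 := pathSet_right_subset h
    rw [pathSet_comm] at h3
    exact pathSet_left_subset h1 (h4 h3)
  · exact pathSet_right_subset h1 (pathSet_left_subset h h3)

theorem segment_axis_subset_VS (hn : 2 ≤ n) (j : Fin 4) {a b : ℝ} (ha : |a| ≤ 1) (hb : |b| ≤ 1) :
    segment ℝ ((a : ℂ) * corner j) (b * corner j) ⊆ VS n := by
  rintro _ ⟨s, t, hs, ht, hst, rfl⟩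
  have : s • ((a : ℂ) * corner j) + t • ((b : ℂ) * corner j) = ((s * a + t * b : ℝ) : ℂ) * corner j := by
    simp only [Complex.real_smul]; push_cast; ring
  rw [this]
  refine axis_mem_VS hn j ?_
  rw [abs_le] at *
  constructor <;> nlinarith

theorem joinedIn_segment {E : Type*} [AddCommGroup E] [Module ℝ E] [TopologicalSpace E]
    [ContinuousAdd E] [ContinuousSMul ℝ E] (a b : E) : JoinedIn (segment ℝ a b) a b :=
  ((convex_segment a b).isPathConnected ⟨a, left_mem_segment ℝ a b⟩).joinedIn a
    (left_mem_segment ℝ a b) b (right_mem_segment ℝ a b)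

/-- The straight segment is one admissible curve, which bounds the path from above. Conversely, the
path between the end corners is covered by the paths over three consecutive pieces, and a point
strictly between a and b can only come from the middle one. -/
theorem pathSet_axis (hn : 2 ≤ n) (j : Fin 4) {a b : ℝ} (ha : |a| ≤ 1) (hb : |b| ≤ 1) :
    pathSet n ((a : ℂ) * corner j) (b * corner j) = segment ℝ ((a : ℂ) * corner j) (b * corner j) := by
  wlog hab : a ≤ b generalizing a b
  · rw [pathSet_comm, segment_symm, this hb ha (le_of_not_ge hab)]
  have hseg : ∀ {a b : ℝ}, |a| ≤ 1 → |b| ≤ 1 →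
      pathSet n ((a : ℂ) * corner j) (b * corner j) ⊆
        segment ℝ ((a : ℂ) * corner j) (b * corner j) := fun ha hb =>
    pathSet_subset_of_joinedIn (segment_axis_subset_VS hn j ha hb) (joinedIn_segment _ _)
  have hcoord : ∀ {a b c : ℝ}, (c : ℂ) * corner j ∈ segment ℝ ((a : ℂ) * corner j) (b * corner j) →
      min a b ≤ c ∧ c ≤ max a b := by
    rintro a b c ⟨s, t, hs, ht, hst, e⟩
    have e := congrArg (coord j) e
    rw [coord_add, Complex.real_smul, Complex.real_smul] at e
    simp only [coord_mul, coord_corner_self, mul_one] at e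
    have h1 := min_le_left a b
    have h2 := min_le_right a b
    have h3 := le_max_left a b
    have h4 := le_max_right a b
    obtain rfl : s = 1 - t := by linarith
    constructor <;> nlinarith
  refine (hseg ha hb).antisymm ?_
  rintro _ ⟨s, t, hs, ht, hst, rfl⟩
  obtain rfl : s = 1 - t := by linarith
  have e : (1 - t) • ((a : ℂ) * corner j) + t • ((b : ℂ) * corner j)
      = (((1 - t) * a + t * b : ℝ) : ℂ) * corner j := by
    simp only [Complex.real_smul]; push_cast; ring
  rw [e]
  set c := (1 - t) * a + t * b with hc
  have hac : a ≤ c := by nlinarith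
  have hcb : c ≤ b := by nlinarith
  rcases hac.eq_or_lt with h | hac
  · rw [← h]; exact left_mem_pathSet n _ _
  rcases hcb.eq_or_lt with h | hcb
  · rw [h]; exact right_mem_pathSet n _ _
  have hcj := segment_corners_subset hn j (s := c) (by
    rw [abs_le] at *; constructor <;> linarith)
  have e1 : corner j = ((1 : ℝ) : ℂ) * corner j := by simp
  have e2 : corner (j + 2) = ((-1 : ℝ) : ℂ) * corner j := by simp [corner_add_two]
  rcases pathSet_subset_union n _ _ ((b : ℂ) * corner j) hcj with h | h
  · replace h : (c : ℂ) * corner j ∈ pathSet n (((1 : ℝ) : ℂ) * corner j) (b * corner j) := by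
      rwa [← e1]
    have := (hcoord (hseg (a := 1) (by simp) hb h)).1
    rw [min_eq_right (abs_le.1 hb).2] at this
    linarith
  rcases pathSet_subset_union n _ _ ((a : ℂ) * corner j) h with h | h
  · rwa [pathSet_comm]
  · rw [e2] at h
    have := (hcoord (hseg ha (b := -1) (by simp) h)).2
    rw [max_eq_left (abs_le.1 ha).1] at this
    linarith

theorem pathDist_axis (hn : 2 ≤ n) (j : Fin 4) {a b : ℝ} (ha : |a| ≤ 1) (hb : |b| ≤ 1) :
    pathDist n ((a : ℂ) * corner j) (b * corner j) = |a - b| := by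
  rw [pathDist, pathSet_axis hn j ha hb, hausdorffMeasure_segment, edist_dist,
    ENNReal.toReal_ofReal dist_nonneg, dist_eq_norm, ← sub_mul, ← Complex.ofReal_sub, norm_mul,
    norm_corner, mul_one, Complex.norm_real, Real.norm_eq_abs]

/-- Zooming into the central cell shows that the path contains all points r^m q_j, where r is the
contraction ratio; it is closed, so it contains their limit. -/
theorem zero_mem_pathSet_corners (hn : 2 ≤ n) {j k : Fin 4} (hjk : j ≠ k) :
    0 ∈ pathSet n (corner j) (corner k) := by
  have hr := ratio_pos hn
  have hne : corner j ≠ corner k := by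
    intro h
    have := congrArg (coord j) h
    rw [coord_corner_self] at this
    linarith [coord_corner_nonpos hjk.symm]
  have key : ∀ m : ℕ, ((ratio n ^ m : ℝ) : ℂ) * corner j ∈ pathSet n (corner j) (corner k) := by
    intro m
    induction m with
    | zero => simpa using left_mem_pathSet n _ _
    | succ m ih =>
      set i : Idx n := Sum.inl ()
      have hi := fun j => (onAxis_inl hn j ()).1
      have h1 := F_retract_mem_pathSet hn (i := i) (x := corner k) (corner_mem_VS j)
        (Or.inr (by rw [hi, hi]; exact hne.symm))
      have h2 := F_retract_mem_pathSet hn (i := i) (x := corner j) (corner_mem_VS k)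
        (Or.inr (by rw [hi, hi]; exact hne))
      rw [pathSet_comm, hi] at h1
      rw [hi] at h2
      have h3 : F n i (((ratio n ^ m : ℝ) : ℂ) * corner j) ∈
          pathSet n (F n i (corner j)) (F n i (corner k)) := by
        rw [pathSet_F hn i (corner_mem_VS _) (corner_mem_VS _)]; exact ⟨_, ih, rfl⟩
      have h4 : F n i (((ratio n ^ m : ℝ) : ℂ) * corner j) ∈ pathSet n (corner j) (corner k) := by
        rcases (pathSet_eq_union h1).subset h2 with h | h
        · rw [pathSet_comm] at h3
          exact pathSet_left_subset h1 (pathSet_right_subset h h3)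
        · exact pathSet_right_subset h1 (pathSet_left_subset h h3)
      convert h4 using 1
      simp only [i, F_eq, cellCenter]; push_cast; ring
  refine (isClosed_pathSet n _ _).mem_of_tendsto (b := atTop) ?_ (Eventually.of_forall key)
  have h1 : Tendsto (fun m : ℕ => ratio n ^ m) atTop (𝓝 0) :=
    tendsto_pow_atTop_nhds_zero_of_lt_one hr.le ((ratio_le hn).trans_lt (by norm_num))
  have h2 := ((Complex.continuous_ofReal.tendsto 0).comp h1).mul_const (corner j)
  simpa using h2

/-- Two points on different arms of the diagonals are separated by the centre. -/
theorem zero_mem_pathSet (hn : 2 ≤ n) {j k : Fin 4} (hjk : j ≠ k) {s t : ℝ} (hs0 : 0 ≤ s)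
    (hs : s ≤ 1) (ht0 : 0 ≤ t) (ht : t ≤ 1) :
    0 ∈ pathSet n ((s : ℂ) * corner j) (t * corner k) := by
  rcases hs0.eq_or_lt with rfl | hs0
  · simpa using left_mem_pathSet n _ _
  rcases ht0.eq_or_lt with rfl | ht0
  · simpa using right_mem_pathSet n _ _
  have key : ∀ (l : Fin 4) (u : ℝ), 0 < u → u ≤ 1 → 0 ∉ pathSet n (corner l) (u * corner l) := by
    intro l u hu hu1 h
    have h' := pathSet_axis hn l (a := 1) (b := u) (by simp) (by rw [abs_of_pos hu]; exact hu1)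
    rw [Complex.ofReal_one, one_mul] at h'
    rw [h'] at h
    obtain ⟨a, b, ha, hb, hab, e⟩ := h
    have e := congrArg (coord l) e
    rw [coord_add, Complex.real_smul, Complex.real_smul] at e
    simp only [coord_mul, coord_corner_self, mul_one] at e
    simp only [coord, mul_zero, Complex.zero_re] at e
    obtain rfl : a = 1 - b := by linarith
    nlinarith
  rcases pathSet_subset_union n _ _ ((s : ℂ) * corner j) (zero_mem_pathSet_corners hn hjk) with h | h
  · exact absurd h (key j s hs0 hs)
  rcases pathSet_subset_union n _ _ ((t : ℂ) * corner k) h with h | h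
  · exact h
  · exact absurd (by rwa [pathSet_comm]) (key k t ht0 ht)

theorem pathDist_diagonals (hn : 2 ≤ n) {j k : Fin 4} (hjk : j ≠ k) {s t : ℝ} (hs0 : 0 ≤ s)
    (hs : s ≤ 1) (ht0 : 0 ≤ t) (ht : t ≤ 1) :
    pathDist n ((s : ℂ) * corner j) (t * corner k) = s + t := by
  have hs' : |s| ≤ 1 := by rwa [abs_of_nonneg hs0]
  have ht' : |t| ≤ 1 := by rwa [abs_of_nonneg ht0]
  rw [pathDist_add hn (axis_mem_VS hn j hs') (axis_mem_VS hn k ht')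
    (zero_mem_pathSet hn hjk hs0 hs ht0 ht)]
  have h1 := pathDist_axis hn j hs' (b := 0) (by simp)
  have h2 := pathDist_axis hn k (a := 0) (by simp) ht'
  simp only [Complex.ofReal_zero, zero_mul, sub_zero, zero_sub, abs_neg, abs_of_nonneg hs0,
    abs_of_nonneg ht0] at h1 h2
  rw [h1, h2]

theorem pathDist_corners (hn : 2 ≤ n) (j k : Fin 4) :
    pathDist n (corner j) (corner k) = if j = k then 0 else 2 := by
  split_ifs with h
  · rw [h, pathDist_self hn (corner_mem_VS k)]
  · have := pathDist_diagonals hn h zero_le_one le_rfl zero_le_one le_rfl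
    simp only [Complex.ofReal_one, one_mul] at this
    rw [this]; norm_num

end Vicsek

end

noncomputable section
namespace Vicsek
variable {n : ℕ} {x y z p q : ℂ}

/-! ## Attachment points -/

theorem joinedIn_diagonals (hp : p ∈ diagonals) (hq : q ∈ diagonals) : JoinedIn diagonals p q :=
  ((joinedIn_segment 0 p).mono (segment_zero_subset hp)).symm.trans
    ((joinedIn_segment 0 q).mono (segment_zero_subset hq))

theorem pathSet_subset_diagonals (hn : 2 ≤ n) (hp : p ∈ diagonals) (hq : q ∈ diagonals) :
    pathSet n p q ⊆ diagonals :=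
  pathSet_subset_of_joinedIn (diagonals_subset_VS hn) (joinedIn_diagonals hp hq)

theorem axis_mem_diagonals (j : Fin 4) {s : ℝ} (hs : |s| ≤ 1) : (s : ℂ) * corner j ∈ diagonals := by
  rw [abs_le] at hs
  rcases le_total 0 s with h | h
  · exact mem_diagonals.2 ⟨j, s, h, hs.2, rfl⟩
  · exact mem_diagonals.2 ⟨j + 2, -s, by linarith, by linarith, by simp [corner_add_two]⟩

theorem isPreconnected_pathSet_diagonals (hn : 2 ≤ n) (hp : p ∈ diagonals) (hq : q ∈ diagonals) :
    IsPreconnected (pathSet n p q) := by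
  have hseg : ∀ {z : ℂ}, z ∈ diagonals → IsPreconnected (pathSet n 0 z) := by
    intro z hz
    obtain ⟨j, t, h0, h1, rfl⟩ := mem_diagonals.1 hz
    have := pathSet_axis hn j (a := 0) (b := t) (by simp) (by rwa [abs_of_nonneg h0])
    rw [Complex.ofReal_zero, zero_mul] at this
    rw [this]
    exact (convex_segment _ _).isPreconnected
  by_cases h : 0 ∈ pathSet n p q
  · rw [pathSet_eq_union h, pathSet_comm n p 0]
    exact (hseg hp).union 0 (left_mem_pathSet n _ _) (left_mem_pathSet n _ _) (hseg hq)
  · obtain ⟨j, s, hs0, hs1, rfl⟩ := mem_diagonals.1 hp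
    obtain ⟨k, t, ht0, ht1, rfl⟩ := mem_diagonals.1 hq
    by_cases hjk : j = k
    · subst hjk
      rw [pathSet_axis hn j (by rwa [abs_of_nonneg hs0]) (by rwa [abs_of_nonneg ht0])]
      exact (convex_segment _ _).isPreconnected
    · exact absurd (zero_mem_pathSet hn hjk hs0 hs1 ht0 ht1) h

theorem attachesAt_of_joinedIn (hz : z ∈ diagonals) (hzV : z ∈ VS n)
    (h : JoinedIn (VS n \ diagonals ∪ {z}) x z) : AttachesAt n x z := by
  refine ⟨hz, Set.Subset.antisymm ?_ ?_⟩
  · rintro p ⟨hp, hpD⟩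
    rcases pathSet_subset_of_joinedIn (Set.union_subset Set.sdiff_subset (by simpa)) h hp with h | h
    · exact absurd hpD h.2
    · exact h
  · rintro _ rfl
    exact ⟨right_mem_pathSet n _ _, hz⟩

theorem exists_attachesAt_mem_range (hn : 2 ≤ n) (hp : p ∈ diagonals)
    (γ : Path x p) (hγ : Set.range γ ⊆ VS n) : ∃ z ∈ Set.range γ, AttachesAt n x z := by
  obtain ⟨z, hz, hzγ, hj⟩ := γ.exists_first_hit hγ isClosed_diagonals hp
  exact ⟨z, hzγ, attachesAt_of_joinedIn hz (diagonals_subset_VS hn hz) hj⟩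

theorem exists_attachesAt (hn : 2 ≤ n) (hx : x ∈ VS n) : ∃ z, AttachesAt n x z := by
  obtain ⟨γ, hγ⟩ := joinedIn_VS hn hx (zero_mem_VS hn)
  obtain ⟨z, -, hz⟩ := exists_attachesAt_mem_range hn zero_mem_diagonals γ
    (by rintro _ ⟨t, rfl⟩; exact hγ t)
  exact ⟨z, hz⟩

/-- The path between two attachment points stays on the diagonals and is covered by the paths to x,
so it consists of at most those two points; being connected, it is a single point. -/
theorem AttachesAt.unique (hn : 2 ≤ n) {w : ℂ} (hz : AttachesAt n x z) (hw : AttachesAt n x w) :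
    z = w := by
  have hsub : pathSet n z w ⊆ {z, w} := by
    intro p hp
    have hpD := pathSet_subset_diagonals hn hz.1 hw.1 hp
    rcases pathSet_subset_union n z w x hp with h | h
    · rw [pathSet_comm] at h
      left; exact hz.2.subset ⟨h, hpD⟩
    · right; exact hw.2.subset ⟨h, hpD⟩
  exact (isPreconnected_pathSet_diagonals hn hz.1 hw.1).subsingleton_of_finite
    ((Set.toFinite _).subset hsub) (left_mem_pathSet n _ _) (right_mem_pathSet n _ _)

/-- The way from `x` to the diagonals leads through the attachment point. -/
theorem AttachesAt.mem_pathSet (hn : 2 ≤ n) (hz : AttachesAt n x z)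
    (hp : p ∈ diagonals) : z ∈ pathSet n x p := by
  intro γ hγ
  obtain ⟨w, hw, hxw⟩ := exists_attachesAt_mem_range hn hp γ hγ
  rwa [hz.unique hn hxw]

theorem AttachesAt.pathDist (hn : 2 ≤ n) (hx : x ∈ VS n) (hz : AttachesAt n x z)
    (hp : p ∈ diagonals) : pathDist n x p = pathDist n x z + pathDist n z p :=
  pathDist_add hn hx (diagonals_subset_VS hn hp) (hz.mem_pathSet hn hp)

theorem AttachesAt.mem_pathSet_of_ne (hn : 2 ≤ n) {w : ℂ} (hz : AttachesAt n x z)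
    (hw : AttachesAt n y w) (hne : z ≠ w) : z ∈ pathSet n x y := by
  rcases pathSet_subset_union n x w y (hz.mem_pathSet hn hw.1) with h | h
  · exact h
  · exact absurd (hw.2.subset ⟨h, hz.1⟩) hne

theorem AttachesAt.pathDist_of_ne (hn : 2 ≤ n) {w : ℂ} (hx : x ∈ VS n) (hy : y ∈ VS n)
    (hz : AttachesAt n x z) (hw : AttachesAt n y w) (hne : z ≠ w) :
    Vicsek.pathDist n x y =
      Vicsek.pathDist n x z + Vicsek.pathDist n z w + Vicsek.pathDist n y w := by
  rw [pathDist_add hn hx hy (hz.mem_pathSet_of_ne hn hw hne), pathDist_comm n z y,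
    hw.pathDist hn hy hz.1, pathDist_comm n w z]
  ring

theorem exists_onArm (hn : 2 ≤ n) (hx : x ∈ VS n) : ∃ j, OnArm n j x := by
  obtain ⟨z, hz⟩ := exists_attachesAt hn hx
  obtain ⟨j, hj⟩ := Set.mem_iUnion.1 hz.1
  exact ⟨j, hx, z, hj, hz⟩

theorem onAxis_exitCorner (hn : 2 ≤ n) (i k : Idx n) : OnAxis n (exitCorner i k) i := by
  rcases i with u | ⟨j, a⟩
  · exact onAxis_inl hn _ u
  · rcases k with _ | ⟨l, b⟩
    · exact (onAxis_inr hn j a).opp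
    · simp only [exitCorner]
      split_ifs
      · exact onAxis_inr hn j a
      · exact (onAxis_inr hn j a).opp

theorem corner_add_two_ne (j : Fin 4) : corner (j + 2) ≠ corner j := by
  intro h
  have := congrArg (coord j) h
  rw [coord_corner_self] at this
  linarith [coord_corner_nonpos (add_two_ne j)]

theorem F_exitCorner_mem_diagonals (hn : 2 ≤ n) (i k : Idx n) :
    F n i (corner (exitCorner i k)) ∈ diagonals := by
  have h := onAxis_exitCorner hn i k
  have := F_retract_mem_pathSet hn (i := i) (x := corner (exitCorner i k + 2))
    (corner_mem_VS (exitCorner i k)) (Or.inr (by rw [h.1, h.2]; exact corner_add_two_ne _))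
  rw [h.1] at this
  exact pathSet_subset_diagonals hn (corner_mem_diagonals _) (corner_mem_diagonals _) this

theorem retract_mem_diagonals (hn : 2 ≤ n) (i : Idx n) (hz : z ∈ diagonals) :
    retract n i z ∈ diagonals := by
  obtain ⟨j, s, h0, h1, rfl⟩ := mem_diagonals.1 hz
  obtain ⟨k, -, t, ht, e⟩ := exists_axis_cell hn j (s := s) (by rwa [abs_of_nonneg h0])
  rw [← e]
  by_cases h : i = k
  · rw [h, retract_F hn k (axis_mem_VS hn j ht)]
    exact axis_mem_diagonals j ht
  · rw [retract_F_of_ne hn h (axis_mem_VS hn j ht)]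
    exact corner_mem_diagonals _

theorem F_inl_zero (u : Unit) : F n (Sum.inl u) 0 = 0 := by simp [F, cellCenter]

/-- Only the centre attaches at the centre. -/
theorem AttachesAt.eq_zero (hn : 2 ≤ n) (hx : x ∈ VS n) (h : AttachesAt n x 0) : x = 0 := by
  have hr := ratio_pos hn
  have key : ∀ (m : ℕ) (x : ℂ), x ∈ VS n → AttachesAt n x 0 → ‖x‖ ≤ ratio n ^ m := by
    intro m
    induction m with
    | zero => intro x hx _; simpa using norm_le_one hn hx
    | succ m ih =>
      intro x hx h
      obtain ⟨i, y, hy, rfl⟩ := exists_cell hn hx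
      rcases i with u | ⟨j, a⟩
      · have hF : ∀ w, F n (Sum.inl u) w = (ratio n : ℂ) * w := fun w => by
          simp [F_eq, cellCenter]
        have hy0 : AttachesAt n y 0 := by
          refine ⟨zero_mem_diagonals, Set.Subset.antisymm ?_ ?_⟩
          · rintro p ⟨hp, hpD⟩
            have h1 : F n (Sum.inl u) p ∈ pathSet n (F n (Sum.inl u) y) (F n (Sum.inl u) 0) := by
              rw [pathSet_F hn _ hy (zero_mem_VS hn)]; exact ⟨p, hp, rfl⟩
            rw [F_inl_zero] at h1
            have h2 : F n (Sum.inl u) p ∈ diagonals := by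
              refine segment_zero_subset hpD ?_
              rw [segment_eq_image', hF]
              exact ⟨ratio n, ⟨hr.le, (ratio_le hn).trans (by norm_num)⟩, by simp⟩
            have h3 : F n (Sum.inl u) p = 0 := h.2.subset ⟨h1, h2⟩
            rw [hF, mul_eq_zero] at h3
            exact h3.resolve_left (ratio_ne_zero hn)
          · rintro _ rfl
            exact ⟨right_mem_pathSet n _ _, zero_mem_diagonals⟩
        rw [hF, norm_mul, Complex.norm_real, Real.norm_of_nonneg hr.le, pow_succ, mul_comm]
        exact mul_le_mul_of_nonneg_right (ih y hy hy0) hr.le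
      -- From a non-central cell, the way to the centre meets the diagonals already at the corner of
      -- that cell facing the centre, which is not the centre itself.
      · exfalso
        have h1 := F_retract_mem_pathSet hn (i := Sum.inr (j, a)) (zero_mem_VS hn)
          (Or.inl ⟨y, hy, rfl⟩)
        have h2 : retract n (Sum.inr (j, a)) 0 =
            corner (exitCorner (Sum.inr (j, a)) (Sum.inl () : Idx n)) := by
          conv in retract n _ _ => rw [← F_inl_zero (n := n) ()]
          exact retract_F_of_ne hn (by simp) (zero_mem_VS hn)
        rw [h2] at h1
        have h3 : F n _ _ = 0 := h.2.subset ⟨h1, F_exitCorner_mem_diagonals hn _ _⟩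
        have h4 := congrArg (coord j) h3
        rw [F_eq, coord_add, coord_mul, cellCenter_inr, coord_mul, exitCorner, corner_add_two,
          ← neg_one_mul, ← Complex.ofReal_one, ← Complex.ofReal_neg, coord_mul,
          coord_corner_self] at h4
        simp only [coord, mul_zero, Complex.zero_re] at h4
        have : (0 : ℝ) ≤ (a : ℕ) := by positivity
        nlinarith
  have : ‖x‖ ≤ 0 := ge_of_tendsto'
    (tendsto_pow_atTop_nhds_zero_of_lt_one hr.le ((ratio_le hn).trans_lt (by norm_num)))
    fun m => key m x hx h
  exact norm_le_zero_iff.1 this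

/-! ## Branch points -/

/-- The path from x to y is connected and covered by the closed paths from x to z and from z to y,
so it contains a point of both. -/
theorem exists_median_diagonals (hn : 2 ≤ n) (hx : x ∈ diagonals) (hy : y ∈ diagonals) (z : ℂ) :
    ∃ w, w ∈ pathSet n x y ∧ w ∈ pathSet n x z ∧ w ∈ pathSet n z y := by
  obtain ⟨w, h1, h2, h3⟩ := isPreconnected_closed_iff.1
    (isPreconnected_pathSet_diagonals hn hx hy) _ _ (isClosed_pathSet n x z)
    (isClosed_pathSet n z y) (pathSet_subset_union n x y z)
    ⟨x, left_mem_pathSet n _ _, left_mem_pathSet n _ _⟩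
    ⟨y, right_mem_pathSet n _ _, right_mem_pathSet n _ _⟩
  exact ⟨w, h1, h2, h3⟩

/-- While x and y share a cell, rescale it and replace z by its retraction, which stays on the
diagonals. Each step enlarges |x - y| by a fixed factor, so this must stop. Once no cell contains
both, their path meets the diagonals, and the median of the attachment points and z serves. -/
theorem exists_median (hn : 2 ≤ n) (hx : x ∈ VS n) (hy : y ∈ VS n) (hz : z ∈ diagonals) :
    ∃ w, w ∈ pathSet n x y ∧ w ∈ pathSet n x z ∧ w ∈ pathSet n z y := by
  have hr := ratio_pos hn
  have key : ∀ (m : ℕ) (x y z : ℂ), x ∈ VS n → y ∈ VS n → z ∈ diagonals →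
      2 * ratio n ^ m < ‖x - y‖ →
      ∃ w, w ∈ pathSet n x y ∧ w ∈ pathSet n x z ∧ w ∈ pathSet n z y := by
    intro m
    induction m with
    | zero =>
      intro x y z hx hy hz h
      exfalso
      have := norm_sub_le x y
      have h1 := norm_le_one hn hx
      have h2 := norm_le_one hn hy
      rw [pow_zero] at h
      linarith
    | succ m ih =>
      intro x y z hx hy hz h
      by_cases hc : ∃ i, x ∈ F n i '' VS n ∧ y ∈ F n i '' VS n
      · obtain ⟨i, ⟨x, hx', rfl⟩, ⟨y, hy', rfl⟩⟩ := hc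
        have hzV := diagonals_subset_VS hn hz
        have hRz := retract_mem_diagonals hn i hz
        have hRzV := retract_mem hn i hzV
        obtain ⟨w, h1, h2, h3⟩ := ih x y (retract n i z) hx' hy' hRz (by
          rw [F_eq, F_eq, add_sub_add_left_eq_sub, ← mul_sub, norm_mul, Complex.norm_real,
            Real.norm_of_nonneg hr.le, pow_succ] at h
          nlinarith)
        refine ⟨F n i w, ?_, ?_, ?_⟩
        · rw [pathSet_F hn i hx' hy']; exact ⟨w, h1, rfl⟩
        · refine pathSet_left_subset
            (F_retract_mem_pathSet hn (i := i) hzV (Or.inl ⟨x, hx', rfl⟩)) ?_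
          rw [pathSet_F hn i hx' hRzV]; exact ⟨w, h2, rfl⟩
        · rw [pathSet_comm]
          refine pathSet_left_subset
            (F_retract_mem_pathSet hn (i := i) hzV (Or.inl ⟨y, hy', rfl⟩)) ?_
          rw [pathSet_comm, pathSet_F hn i hRzV hy']; exact ⟨w, h3, rfl⟩
      · obtain ⟨a, ha⟩ := exists_attachesAt hn hx
        obtain ⟨b, hb⟩ := exists_attachesAt hn hy
        have hmeet : ∃ e ∈ diagonals, e ∈ pathSet n x y := by
          obtain ⟨i, x', hx', rfl⟩ := exists_cell hn hx
          obtain ⟨k, y', hy', rfl⟩ := exists_cell hn hy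
          have hik : i ≠ k := by
            rintro rfl; exact hc ⟨i, ⟨x', hx', rfl⟩, ⟨y', hy', rfl⟩⟩
          have := F_retract_mem_pathSet hn (i := i) hy (Or.inl ⟨x', hx', rfl⟩)
          rw [retract_F_of_ne hn hik hy'] at this
          exact ⟨_, F_exitCorner_mem_diagonals hn i k, this⟩
        obtain ⟨e, he, hexy⟩ := hmeet
        have haxy : a ∈ pathSet n x y := pathSet_left_subset hexy (ha.mem_pathSet hn he)
        have hab : pathSet n a b ⊆ pathSet n x y := by
          have : pathSet n a y ⊆ pathSet n x y := pathSet_right_subset haxy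
          refine subset_trans (pathSet_left_subset ?_) this
          rw [pathSet_comm]
          exact hb.mem_pathSet hn ha.1
        obtain ⟨w, h1, h2, h3⟩ := exists_median_diagonals hn ha.1 hb.1 z
        refine ⟨w, hab h1, pathSet_right_subset (ha.mem_pathSet hn hz) h2, ?_⟩
        refine pathSet_left_subset ?_ h3
        rw [pathSet_comm]
        exact hb.mem_pathSet hn hz
  by_cases hxy : x = y
  · subst hxy
    exact ⟨x, left_mem_pathSet n _ _, left_mem_pathSet n _ _, right_mem_pathSet n _ _⟩
  · have h0 : 0 < ‖x - y‖ := norm_sub_pos_iff.2 hxy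
    obtain ⟨m, hm⟩ := exists_pow_lt_of_lt_one (half_pos h0)
      ((ratio_le hn).trans_lt (by norm_num : (1 / 3 : ℝ) < 1))
    exact key m x y z hx hy hz (by linarith)

/-- The median is the last common point: beyond it the two branches form the halves of the path from
x to y, which meet only there. Additivity of length along the three paths gives the distance
identity. -/
theorem exists_isLastCommon (hn : 2 ≤ n) (hx : x ∈ VS n) (hy : y ∈ VS n) (hz : z ∈ diagonals) :
    ∃ w, IsLastCommon n z x y w ∧ (∀ w', IsLastCommon n z x y w' → w' = w) ∧
      pathDist n x y = pathDist n x z + pathDist n y z - 2 * pathDist n z w := by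
  have hzV := diagonals_subset_VS hn hz
  obtain ⟨w, hxy, hxz, hzy⟩ := exists_median hn hx hy hz
  have hwV := pathSet_subset_VS hn hx hy hxy
  have hzx : w ∈ pathSet n z x := by rwa [pathSet_comm]
  have hlast : IsLastCommon n z x y w := by
    refine ⟨⟨hzx, hzy⟩, ?_⟩
    rintro q ⟨h1, h2⟩
    rcases (pathSet_eq_union hzx).subset h1 with h1 | h1
    · exact h1
    rcases (pathSet_eq_union hzy).subset h2 with h2 | h2
    · exact h2
    have := (pathSet_inter_eq (joinedIn_VS hn hx hwV) (joinedIn_VS hn hy hwV) hxy).subset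
      ⟨by rwa [pathSet_comm], h2⟩
    obtain rfl : q = w := this
    exact right_mem_pathSet n _ _
  refine ⟨w, hlast, fun w' hw' => ?_, ?_⟩
  · have h1 := hw'.2 hlast.1
    have h2 := hlast.2 hw'.1
    exact eq_of_mem_pathSet_of_mem_pathSet
      (joinedIn_VS hn hzV (pathSet_subset_VS hn hzV hx hw'.1.1)) h1 h2
  · rw [pathDist_add hn hx hy hxy, pathDist_add hn hx hzV hxz, pathDist_comm n y z,
      pathDist_add hn hzV hy hzy, pathDist_comm n w z]
    ring

/-! ## Continuity of the path metric -/

/-- Points near x lie only in cells containing x, and inside each such cell the continuous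
retraction reduces the claim to the previous scale. -/
theorem eventually_pathDist_le (hn : 2 ≤ n) (m : ℕ) (hx : x ∈ VS n) :
    ∀ᶠ y in 𝓝[VS n] x, pathDist n x y ≤ 4 * ratio n ^ m := by
  have hr := ratio_pos hn
  induction m generalizing x with
  | zero =>
    filter_upwards [self_mem_nhdsWithin] with y hy
    simpa using pathDist_le hn hx hy
  | succ m ih =>
    have key : ∀ i, ∀ᶠ y in 𝓝[VS n] x, y ∈ F n i '' VS n → pathDist n x y ≤ 4 * ratio n ^ (m + 1) := by
      intro i
      by_cases hxi : x ∈ F n i '' VS n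
      · obtain ⟨x, hx', rfl⟩ := hxi
        have h1 : Tendsto (retract n i) (𝓝[VS n] (F n i x)) (𝓝[VS n] x) := by
          refine tendsto_nhdsWithin_iff.2 ⟨?_, ?_⟩
          · have := retract_continuousOn hn i _ hx
            rwa [ContinuousWithinAt, retract_F hn i hx'] at this
          · filter_upwards [self_mem_nhdsWithin] with y hy using retract_mem hn i hy
        filter_upwards [h1.eventually (ih hx')] with y hy hyc
        obtain ⟨y, hy', rfl⟩ := hyc
        rw [retract_F hn i hy'] at hy
        rw [pathDist_F hn i hx' hy', pow_succ]
        nlinarith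
      · filter_upwards [nhdsWithin_le_nhds ((isClosed_cell hn i).isOpen_compl.mem_nhds hxi)]
          with y hy hyc
        exact absurd hyc hy
    filter_upwards [eventually_all.2 key, self_mem_nhdsWithin] with y hy hyV
    obtain ⟨i, y', hy', e⟩ := exists_cell hn hyV
    exact hy i ⟨y', hy', e⟩

theorem pathDist_continuousOn (hn : 2 ≤ n) (hp : p ∈ VS n) :
    ContinuousOn (fun x => pathDist n x p) (VS n) := by
  intro x hx
  rw [ContinuousWithinAt, Metric.tendsto_nhds]
  intro ε hε
  obtain ⟨m, hm⟩ := exists_pow_lt_of_lt_one (by positivity : 0 < ε / 4)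
    ((ratio_le hn).trans_lt (by norm_num : (1 / 3 : ℝ) < 1))
  filter_upwards [eventually_pathDist_le hn m hx, self_mem_nhdsWithin] with y hy hyV
  have h1 := pathDist_triangle hn hx hp hyV
  have h2 := pathDist_triangle hn hyV hp hx
  rw [pathDist_comm n y x] at h2
  rw [Real.dist_eq, abs_lt]
  constructor <;> linarith

end Vicsek

end

noncomputable section
namespace Vicsek
variable {n : ℕ} {x y z p q : ℂ} {u u' v v' : ℂ → ℝ}

/-! ## Graph energies -/

theorem graphEnergy_comm (n m : ℕ) (u v : ℂ → ℝ) : graphEnergy n m u v = graphEnergy n m v u := by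
  simp only [graphEnergy, mul_comm]

theorem renormEnergy_comm (n m : ℕ) (u v : ℂ → ℝ) : renormEnergy n m u v = renormEnergy n m v u := by
  rw [renormEnergy, graphEnergy_comm, renormEnergy]

theorem HasEnergy.symm {e : ℝ} (h : HasEnergy n u v e) : HasEnergy n v u e := by
  simpa only [HasEnergy, renormEnergy_comm n _ v u] using h

theorem renormEnergy_congr_add_const (hn : 2 ≤ n) (m : ℕ) {c : ℝ}
    (hu : ∀ x ∈ VS n, u x = u' x + c) (hv : ∀ x ∈ VS n, v x = v' x) :
    renormEnergy n m u v = renormEnergy n m u' v' := by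
  have h : ∀ (w : Fin m → Idx n) (j : Fin 4), wordMap n w (corner j) ∈ VS n := fun w j =>
    wordMap_mem_VS hn w (corner_mem_VS j)
  simp only [renormEnergy, graphEnergy, hu _ (h _ _), hv _ (h _ _), add_sub_add_right_eq_sub]

theorem renormEnergy_congr (hn : 2 ≤ n) (m : ℕ)
    (hu : ∀ x ∈ VS n, u x = u' x) (hv : ∀ x ∈ VS n, v x = v' x) :
    renormEnergy n m u v = renormEnergy n m u' v' :=
  renormEnergy_congr_add_const hn m (c := 0) (by simpa using hu) hv

/-- The renormalized graph energy as a linear functional of its first argument. -/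
def energyFunctional (n m : ℕ) (v : ℂ → ℝ) : (ℂ → ℝ) →ₗ[ℝ] ℝ where
  toFun u := renormEnergy n m u v
  map_add' u u' := by
    simp only [renormEnergy, graphEnergy, ← mul_add, ← Finset.sum_add_distrib, Pi.add_apply]
    refine congrArg _ (Finset.sum_congr rfl fun w _ => Finset.sum_congr rfl fun i _ =>
      Finset.sum_congr rfl fun j _ => ?_)
    ring
  map_smul' c u := by
    simp only [renormEnergy, graphEnergy, Finset.mul_sum, Pi.smul_apply, smul_eq_mul,
      RingHom.id_apply]
    refine Finset.sum_congr rfl fun w _ => Finset.sum_congr rfl fun i _ =>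
      Finset.sum_congr rfl fun j _ => ?_
    ring

theorem energyFunctional_apply (n m : ℕ) (u v : ℂ → ℝ) :
    energyFunctional n m v u = renormEnergy n m u v := rfl

theorem graphEnergy_succ (n m : ℕ) (u v : ℂ → ℝ) :
    graphEnergy n (m + 1) u v =
      ∑ i, graphEnergy n m (fun x => u (F n i x)) (fun x => v (F n i x)) := by
  simp only [graphEnergy]
  rw [← (Fin.consEquiv fun _ : Fin (m + 1) => Idx n).sum_comp, Fintype.sum_prod_type]
  refine Finset.sum_congr rfl fun i _ => Finset.sum_congr rfl fun w _ => ?_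
  have h : ∀ z, wordMap n (Fin.consEquiv (fun _ : Fin (m + 1) => Idx n) (i, w)) z =
      F n i (wordMap n w z) := wordMap_cons i w
  simp only [h]

theorem renormEnergy_succ (n m : ℕ) (u v : ℂ → ℝ) :
    renormEnergy n (m + 1) u v = (2 * (n : ℝ) - 1) *
      ∑ i, renormEnergy n m (fun x => u (F n i x)) (fun x => v (F n i x)) := by
  simp only [renormEnergy, graphEnergy_succ, ← Finset.mul_sum, pow_succ]
  ring

theorem renormEnergy_zero (n : ℕ) (u v : ℂ → ℝ) :
    renormEnergy n 0 u v = 1 / 4 * (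
      (u (corner 0) - u (corner 1)) * (v (corner 0) - v (corner 1)) +
      (u (corner 0) - u (corner 2)) * (v (corner 0) - v (corner 2)) +
      (u (corner 0) - u (corner 3)) * (v (corner 0) - v (corner 3)) +
      (u (corner 1) - u (corner 2)) * (v (corner 1) - v (corner 2)) +
      (u (corner 1) - u (corner 3)) * (v (corner 1) - v (corner 3)) +
      (u (corner 2) - u (corner 3)) * (v (corner 2) - v (corner 3))) := by
  have h0 : Finset.Ioi (0 : Fin 4) = {1, 2, 3} := by decide
  have h1 : Finset.Ioi (1 : Fin 4) = {2, 3} := by decide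
  have h2 : Finset.Ioi (2 : Fin 4) = {3} := by decide
  have h3 : Finset.Ioi (3 : Fin 4) = ∅ := by decide
  simp only [renormEnergy, graphEnergy, wordMap_zero, Finset.univ_unique, Finset.sum_singleton,
    Fin.sum_univ_four, h0, h1, h2, h3, Finset.sum_empty]
  rw [Finset.sum_insert (by decide), Finset.sum_pair (by decide), Finset.sum_pair (by decide)]
  ring

/-! ## Summation along a path of cells -/

/-- Here h lists the values at the junctions along an arm, b is the index of the cell containing the
target point and Y is the value there: cells before b see the target through their outer corner,
later ones through their inner corner. -/
theorem sum_range_telescope (h : ℕ → ℝ) (Y : ℝ) (b N : ℕ) :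
    ∑ a ∈ Finset.range N, ((if a < b then h (a + 1) else if a = b then Y else h a) - h a) =
      if N ≤ b then h N - h 0 else Y - h 0 := by
  induction N with
  | zero => simp
  | succ N ih =>
    rw [Finset.sum_range_succ, ih]
    rcases lt_trichotomy N b with hb | hb | hb
    · simp [hb, hb.le, Nat.succ_le_of_lt hb]
    · simp [hb]
    · simp [not_le.2 hb, not_lt.2 hb.le, hb.ne', show ¬ N + 1 ≤ b by omega]

theorem F_inr_corner (j : Fin 4) (a : Fin (n - 1)) :
    F n (Sum.inr (j, a)) (corner j) = (((2 * (((a : ℕ) + 1 : ℕ) : ℝ) + 1) * ratio n : ℝ) : ℂ) * corner j := by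
  rw [F_eq, cellCenter_inr]; push_cast; ring

theorem F_inr_corner_add_two (j : Fin 4) (a : Fin (n - 1)) :
    F n (Sum.inr (j, a)) (corner (j + 2)) = (((2 * ((a : ℕ) : ℝ) + 1) * ratio n : ℝ) : ℂ) * corner j := by
  rw [F_eq, cellCenter_inr, corner_add_two]; push_cast; ring

/-- The cells between the centre and y contribute telescoping increments, and the other cells only
their inner corner. The correction term does not depend on y, so for two points the cell
contributions add up to the difference of the values of v. -/
theorem sum_F_retract (hn : 2 ≤ n) (v : ℂ → ℝ) (hy : y ∈ VS n) :
    ∑ i, v (F n i (retract n i y)) =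
      v y + ∑ j, ∑ a, v (F n (Sum.inr (j, a)) (corner (j + 2))) := by
  obtain ⟨k, y, hy', rfl⟩ := exists_cell hn hy
  rw [Fintype.sum_sum_type, Fintype.sum_prod_type]
  simp only [Finset.univ_unique, Finset.sum_singleton]
  rcases k with u | ⟨j, b⟩
  · rw [retract_F hn _ hy']
    congr 1
    refine Finset.sum_congr rfl fun j _ => Finset.sum_congr rfl fun a _ => ?_
    rw [retract_F_of_ne hn (by simp) hy', exitCorner]
  · rw [retract_F_of_ne hn (by simp) hy']
    simp only [exitCorner]
    have hoff : ∀ l, l ≠ j → ∀ a, retract n (Sum.inr (l, a)) (F n (Sum.inr (j, b)) y) = corner (l + 2) := by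
      intro l hl a
      rw [retract_F_of_ne hn (by simp [hl]) hy']
      simp [exitCorner, hl.symm]
    rw [← Finset.add_sum_erase _ _ (Finset.mem_univ j),
      ← Finset.add_sum_erase _ (fun j => ∑ a, v (F n (Sum.inr (j, a)) (corner (j + 2)))) (Finset.mem_univ j)]
    have herase : ∑ l ∈ Finset.univ.erase j, ∑ a, v (F n (Sum.inr (l, a))
        (retract n (Sum.inr (l, a)) (F n (Sum.inr (j, b)) y))) =
        ∑ l ∈ Finset.univ.erase j, ∑ a, v (F n (Sum.inr (l, a)) (corner (l + 2))) :=
      Finset.sum_congr rfl fun l hl => Finset.sum_congr rfl fun a _ => by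
        rw [hoff l (Finset.ne_of_mem_erase hl)]
    rw [herase, ← add_assoc, ← add_assoc]
    congr 1
    set h : ℕ → ℝ := fun a => v ((((2 * (a : ℝ) + 1) * ratio n : ℝ) : ℂ) * corner j) with hh
    have h0 : v (F n (Sum.inl default) (corner j)) = h 0 := by
      simp only [hh, F_eq, cellCenter]; congr 1; push_cast; ring
    have h1 : ∀ a : Fin (n - 1), v (F n (Sum.inr (j, a)) (corner (j + 2))) = h a := fun a => by
      rw [F_inr_corner_add_two]
    have h2 : ∀ a : Fin (n - 1), v (F n (Sum.inr (j, a))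
        (retract n (Sum.inr (j, a)) (F n (Sum.inr (j, b)) y))) =
        if (a : ℕ) < b then h (a + 1) else if (a : ℕ) = b then v (F n (Sum.inr (j, b)) y) else h a := by
      intro a
      by_cases hab : a = b
      · subst hab
        rw [retract_F hn _ hy']; simp
      · rw [retract_F_of_ne hn (by simp [hab]) hy']
        by_cases hlt : a < b
        · have hlt' : (a : ℕ) < b := hlt
          simp only [exitCorner, hlt, and_self, if_true, if_pos hlt', F_inr_corner, hh]
        · have hlt' : ¬ (a : ℕ) < b := hlt
          have hne : ¬ (a : ℕ) = b := fun e => hab (Fin.ext e)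
          simp only [exitCorner, hlt, and_false, if_false, if_neg hlt', if_neg hne, h1]
    simp only [h0, h1, h2]
    have key := sum_range_telescope h (v (F n (Sum.inr (j, b)) y)) b (n - 1)
    rw [if_neg (by have := b.2; omega), Finset.sum_sub_distrib, Finset.sum_range, Finset.sum_range] at key
    linarith

/-! ## The energy of the distance functions -/

/-- The deviation of `v ↦ ℰ(d(·, y) - d(·, y'), v)` at level `m` from `-2 (v y - v y')`. -/
def defect (n m : ℕ) (y y' : ℂ) (v : ℂ → ℝ) : ℝ :=
  renormEnergy n m (fun x => pathDist n x y - pathDist n x y') v + 2 * (v y - v y')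

/-- On each cell the difference of distances is, up to a constant, the contraction ratio times the
difference for the retracted points. That ratio cancels the renormalization, and `sum_F_retract`
splits the point values. -/
theorem defect_succ (hn : 2 ≤ n) (m : ℕ) (hx : x ∈ VS n) (hy : y ∈ VS n) (v : ℂ → ℝ) :
    defect n (m + 1) x y v =
      ∑ i, defect n m (retract n i x) (retract n i y) (fun z => v (F n i z)) := by
  have h1 : ∀ i, renormEnergy n m (fun z => pathDist n (F n i z) x - pathDist n (F n i z) y)
      (fun z => v (F n i z)) = ratio n * renormEnergy n m
      (fun z => pathDist n z (retract n i x) - pathDist n z (retract n i y))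
      (fun z => v (F n i z)) := by
    intro i
    rw [← energyFunctional_apply n m (fun z => pathDist n z _ - _), ← smul_eq_mul, ← map_smul,
      energyFunctional_apply]
    refine renormEnergy_congr_add_const hn m (c := pathDist n (F n i (retract n i x)) x -
      pathDist n (F n i (retract n i y)) y) (fun z hz => ?_) fun _ _ => rfl
    rw [pathDist_F_left hn i hz hx, pathDist_F_left hn i hz hy]
    simp only [Pi.smul_apply, smul_eq_mul]; ring
  have h2 := sum_F_retract hn v hx
  have h3 := sum_F_retract hn v hy
  simp only [defect, Finset.sum_add_distrib, ← Finset.mul_sum, Finset.sum_sub_distrib]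
  rw [renormEnergy_succ, h2, h3]
  simp only [h1, ← Finset.mul_sum]
  rw [← mul_assoc, mul_ratio hn]
  ring

/-- Retractions send corners to corners, so the recursion reduces everything to a finite check at
level 0. -/
theorem defect_corners (hn : 2 ≤ n) (m : ℕ) (j k : Fin 4) (v : ℂ → ℝ) :
    defect n m (corner j) (corner k) v = 0 := by
  induction m generalizing j k v with
  | zero =>
    rw [defect, renormEnergy_zero]
    simp only [pathDist_corners hn]
    fin_cases j <;> fin_cases k <;> simp <;> ring
  | succ m ih =>
    rw [defect_succ hn m (corner_mem_VS j) (corner_mem_VS k)]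
    refine Finset.sum_eq_zero fun i _ => ?_
    obtain ⟨j', hj⟩ := retract_corner hn i j
    obtain ⟨k', hk⟩ := retract_corner hn i k
    rw [hj, hk, ih]

/-- Every cell other than a chosen one containing y sees both points as corners and contributes
nothing. Following y down m levels leaves one level-0 defect, with v restricted to an m-cell. -/
theorem abs_defect_le (hn : 2 ≤ n) {m : ℕ} (hy : y ∈ VS n) (j : Fin 4) {v : ℂ → ℝ} {ε : ℝ}
    (hv : ∀ w : Fin m → Idx n, ∀ p ∈ VS n, ∀ q ∈ VS n,
      |v (wordMap n w p) - v (wordMap n w q)| ≤ ε) :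
    |defect n m y (corner j) v| ≤ 8 * ε := by
  induction m generalizing y j v with
  | zero =>
    simp only [wordMap_zero] at hv
    replace hv := hv Fin.elim0
    have hc := fun k => corner_mem_VS (n := n) k
    have hd : ∀ k l : Fin 4, ∀ p ∈ VS n, |pathDist n (corner k) p - pathDist n (corner l) p| ≤ 2 := by
      intro k l p hp
      have h1 := pathDist_triangle hn (hc k) hp (hc l)
      have h2 := pathDist_triangle hn (hc l) hp (hc k)
      have h3 : ∀ k l, pathDist n (corner k) (corner l) ≤ 2 := fun k l => by
        rw [pathDist_corners hn]; split_ifs <;> norm_num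
      have h4 := h3 k l
      have h5 := h3 l k
      rw [abs_le]; constructor <;> linarith
    have hterm : ∀ k l : Fin 4,
        |((pathDist n (corner k) y - pathDist n (corner k) (corner j)) -
          (pathDist n (corner l) y - pathDist n (corner l) (corner j))) *
          (v (corner k) - v (corner l))| ≤ 4 * ε := by
      intro k l
      rw [abs_mul]
      refine mul_le_mul ?_ (hv _ (hc k) _ (hc l)) (abs_nonneg _) (by norm_num)
      have h1 := abs_le.1 (hd k l y hy)
      have h2 := abs_le.1 (hd k l _ (hc j))
      rw [abs_le]; constructor <;> linarith
    -- Six edge terms of size 4ε with weight 1/4, plus twice ε, give 8ε.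
    have h7 := abs_le.1 (hv y hy _ (hc j))
    have a1 := abs_le.1 (hterm 0 1)
    have a2 := abs_le.1 (hterm 0 2)
    have a3 := abs_le.1 (hterm 0 3)
    have a4 := abs_le.1 (hterm 1 2)
    have a5 := abs_le.1 (hterm 1 3)
    have a6 := abs_le.1 (hterm 2 3)
    rw [defect, renormEnergy_zero, abs_le]
    constructor <;> linarith
  | succ m ih =>
    rw [defect_succ hn m hy (corner_mem_VS j)]
    obtain ⟨i, y, hy', rfl⟩ := exists_cell hn hy
    rw [Finset.sum_eq_single_of_mem i (Finset.mem_univ i)]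
    · obtain ⟨k, hk⟩ := retract_corner hn i j
      rw [hk, retract_F hn i hy']
      refine ih hy' k fun w p hp q hq => ?_
      simpa only [wordMap_cons] using hv (Fin.cons i w) p hp q hq
    · intro k _ hki
      obtain ⟨l, hl⟩ := retract_corner hn k j
      rw [hl, retract_F_of_ne hn hki hy', defect_corners hn]

theorem norm_wordMap_sub (hn : 2 ≤ n) {m : ℕ} (w : Fin m → Idx n) (p q : ℂ) :
    ‖wordMap n w p - wordMap n w q‖ = ratio n ^ m * ‖p - q‖ := by
  induction m with
  | zero => simp [wordMap_zero]
  | succ m ih =>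
    rw [← Fin.cons_self_tail w, wordMap_cons, wordMap_cons, F_eq, F_eq, add_sub_add_left_eq_sub,
      ← mul_sub, norm_mul, ih, Complex.norm_real, Real.norm_of_nonneg (ratio_pos hn).le, pow_succ]
    ring

theorem exists_oscillation_le (hn : 2 ≤ n) (hv : ContinuousOn v (VS n)) {ε : ℝ} (hε : 0 < ε) :
    ∃ N, ∀ m ≥ N, ∀ w : Fin m → Idx n, ∀ p ∈ VS n, ∀ q ∈ VS n,
      |v (wordMap n w p) - v (wordMap n w q)| ≤ ε := by
  have hr := ratio_pos hn
  obtain ⟨δ, hδ, h⟩ := Metric.uniformContinuousOn_iff.1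
    ((isCompact_VS hn).uniformContinuousOn_of_continuous hv) ε hε
  obtain ⟨N, hN⟩ := exists_pow_lt_of_lt_one (half_pos hδ)
    ((ratio_le hn).trans_lt (by norm_num : (1 / 3 : ℝ) < 1))
  refine ⟨N, fun m hm w p hp q hq => ?_⟩
  have h1 : ratio n ^ m ≤ ratio n ^ N :=
    pow_le_pow_of_le_one hr.le ((ratio_le hn).trans (by norm_num)) hm
  have h2 : ‖p - q‖ ≤ 2 := by
    linarith [norm_sub_le p q, norm_le_one hn hp, norm_le_one hn hq]
  have h3 : 0 < ratio n ^ m := by positivity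
  have := h _ (wordMap_mem_VS hn w hp) _ (wordMap_mem_VS hn w hq) (by
    rw [dist_eq_norm, norm_wordMap_sub hn]; nlinarith)
  exact this.le

/-! ## The Green's function -/

/-- The sum of the distances to the four boundary points. -/
def cornerSum (n : ℕ) (x : ℂ) : ℝ := ∑ j, pathDist n x (corner j)

/-- The Dirichlet Green's function in terms of the path metric. -/
def green (n : ℕ) (x y : ℂ) : ℝ :=
  -pathDist n x y / 2 + (cornerSum n x + cornerSum n y) / 8 + cornerSum n x * cornerSum n y / 16 -
    (∑ j, pathDist n x (corner j) * pathDist n y (corner j)) / 4 - 3 / 4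

theorem green_comm (n : ℕ) (x y : ℂ) : green n x y = green n y x := by
  simp only [green, pathDist_comm n x y, mul_comm, add_comm]

theorem green_continuousOn (hn : 2 ≤ n) (hy : y ∈ VS n) :
    ContinuousOn (fun x => green n x y) (VS n) := by
  have h := fun j => pathDist_continuousOn hn (corner_mem_VS j)
  have h' := pathDist_continuousOn hn hy
  unfold green cornerSum
  fun_prop

theorem green_corner (hn : 2 ≤ n) (k : Fin 4) (y : ℂ) : green n (corner k) y = 0 := by
  rw [green, cornerSum, cornerSum]
  simp only [Fin.sum_univ_four, pathDist_corners hn, pathDist_comm n (corner k) y]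
  fin_cases k <;> simp <;> ring

/-- The coefficients are the harmonic weights of y at the corners; they sum to 1, so `green` is, up
to a constant in x, -1/2 times the weighted mean of the differences d(·,y) - d(·,q_j). -/
theorem renormEnergy_green (hn : 2 ≤ n) (m : ℕ) (y : ℂ) (hv : ∀ j, v (corner j) = 0) :
    renormEnergy n m (fun x => green n x y) v = v y - 1 / 2 * ∑ j,
      (1 / 4 + cornerSum n y / 8 - pathDist n y (corner j) / 2) * defect n m y (corner j) v := by
  set α : Fin 4 → ℝ := fun j => 1 / 4 + cornerSum n y / 8 - pathDist n y (corner j) / 2 with hα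
  have hs : ∑ j, α j = 1 := by
    simp only [hα, cornerSum, Fin.sum_univ_four]; ring
  have h1 : renormEnergy n m (fun x => green n x y) v = renormEnergy n m
      (∑ j, (-(1 / 2) * α j) • fun x => pathDist n x y - pathDist n x (corner j)) v := by
    refine renormEnergy_congr_add_const hn m (c := cornerSum n y / 8 - 3 / 4) (fun x _ => ?_)
      fun _ _ => rfl
    simp only [green, Finset.sum_apply, Pi.smul_apply, smul_eq_mul, hα, cornerSum, Fin.sum_univ_four]
    ring
  have h2 : ∀ j, renormEnergy n m (fun x => pathDist n x y - pathDist n x (corner j)) v =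
      defect n m y (corner j) v - 2 * v y := fun j => by
    rw [defect, hv]; ring
  rw [h1, ← energyFunctional_apply, map_sum]
  simp only [map_smul, energyFunctional_apply, h2, smul_eq_mul]
  simp only [Fin.sum_univ_four] at hs ⊢
  linear_combination (v y) * hs

theorem abs_renormEnergy_green_sub_le (hn : 2 ≤ n) (hv : ContinuousOn v (VS n))
    (hv0 : ∀ j, v (corner j) = 0) {ε : ℝ} (hε : 0 < ε) :
    ∃ N, ∀ m ≥ N, ∀ y ∈ VS n, |renormEnergy n m (fun x => green n x y) v - v y| ≤ ε := by
  -- With coefficients bounded by 5 and defects by 8ε/80, four terms times 1/2 give ε.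
  obtain ⟨N, hN⟩ := exists_oscillation_le hn hv (ε := ε / 80) (by positivity)
  refine ⟨N, fun m hm y hy => ?_⟩
  rw [renormEnergy_green hn m y hv0, sub_sub_cancel_left, abs_neg, abs_mul]
  have hd : ∀ j, 0 ≤ pathDist n y (corner j) ∧ pathDist n y (corner j) ≤ 4 := fun j =>
    ⟨pathDist_nonneg n _ _, pathDist_le hn hy (corner_mem_VS j)⟩
  have hα : ∀ j, |(1 / 4 + cornerSum n y / 8 - pathDist n y (corner j) / 2) *
      defect n m y (corner j) v| ≤ 5 * (8 * (ε / 80)) := by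
    intro j
    rw [abs_mul]
    refine mul_le_mul ?_ (abs_defect_le hn hy j (hN m hm)) (abs_nonneg _) (by norm_num)
    have h0 := hd 0
    have h1 := hd 1
    have h2 := hd 2
    have h3 := hd 3
    have hj := hd j
    rw [cornerSum, Fin.sum_univ_four, abs_le]
    constructor <;> linarith
  have := (Finset.abs_sum_le_sum_abs _ _).trans (Finset.sum_le_sum fun j (_ : j ∈ Finset.univ) => hα j)
  rw [Finset.sum_const, Finset.card_univ, Fintype.card_fin, nsmul_eq_mul] at this
  rw [abs_of_nonneg (by norm_num : (0 : ℝ) ≤ 1 / 2)]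
  push_cast at this
  linarith

theorem hasEnergy_green (hn : 2 ≤ n) (hy : y ∈ VS n) (hv : ContinuousOn v (VS n))
    (hv0 : ∀ j, v (corner j) = 0) : HasEnergy n (fun x => green n x y) v (v y) := by
  refine Metric.tendsto_atTop.2 fun ε hε => ?_
  obtain ⟨N, hN⟩ := abs_renormEnergy_green_sub_le hn hv hv0 (half_pos hε)
  refine ⟨N, fun m hm => ?_⟩
  rw [Real.dist_eq]
  linarith [hN m hm y hy]

/-- Finite energy is obtained by testing the reproducing identity on the function itself, which is
legitimate because that identity only asks for continuity and zero boundary values. -/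
theorem inDomZero_green (hn : 2 ≤ n) (hy : y ∈ VS n) : InDomZero n (fun x => green n x y) :=
  ⟨⟨green_continuousOn hn hy, _, hasEnergy_green hn hy (green_continuousOn hn hy)
    fun j => green_corner hn j y⟩, fun j => green_corner hn j y⟩

theorem isDirichletGreen_green (hn : 2 ≤ n) : IsDirichletGreen n (green n) := fun _ hy =>
  ⟨inDomZero_green hn hy, fun _ hv => hasEnergy_green hn hy hv.1.1 hv.2⟩

/-- The energy of G(·,y) against `green`(·,x) is evaluated by the reproducing property of each
factor in turn. -/
theorem IsDirichletGreen.eq_green (hn : 2 ≤ n) {G : ℂ → ℂ → ℝ} (hG : IsDirichletGreen n G)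
    (hx : x ∈ VS n) (hy : y ∈ VS n) : G x y = green n x y := by
  have h1 := hasEnergy_green hn hx (hG y hy).1.1.1 (hG y hy).1.2
  have h2 := (hG y hy).2 _ (inDomZero_green hn hx)
  rw [tendsto_nhds_unique h1 h2.symm, green_comm]

/-! ## The Green operator -/

instance : IsFiniteMeasure (stdMeasure n) := by
  unfold stdMeasure; infer_instance

theorem green_continuousOn_right (hn : 2 ≤ n) (hx : x ∈ VS n) :
    ContinuousOn (fun y => green n x y) (VS n) := by
  simpa only [green_comm n x] using green_continuousOn hn hx

theorem abs_green_le (hn : 2 ≤ n) (hx : x ∈ VS n) (hy : y ∈ VS n) : |green n x y| ≤ 200 := by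
  have hd : ∀ z ∈ VS n, ∀ w ∈ VS n, 0 ≤ pathDist n z w ∧ pathDist n z w ≤ 4 := fun z hz w hw =>
    ⟨pathDist_nonneg n _ _, pathDist_le hn hz hw⟩
  have hs : ∀ z ∈ VS n, 0 ≤ cornerSum n z ∧ cornerSum n z ≤ 16 := fun z hz => by
    have h := fun j => hd z hz _ (corner_mem_VS j)
    have h0 := h 0; have h1 := h 1; have h2 := h 2; have h3 := h 3
    rw [cornerSum, Fin.sum_univ_four]; constructor <;> linarith
  have hp : ∀ j, 0 ≤ pathDist n x (corner j) * pathDist n y (corner j) ∧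
      pathDist n x (corner j) * pathDist n y (corner j) ≤ 16 := fun j => by
    have h1 := hd x hx _ (corner_mem_VS j)
    have h2 := hd y hy _ (corner_mem_VS j)
    exact ⟨mul_nonneg h1.1 h2.1, by nlinarith⟩
  have h0 := hp 0; have h1 := hp 1; have h2 := hp 2; have h3 := hp 3
  have hx' := hs x hx
  have hy' := hs y hy
  have hxy := hd x hx y hy
  have hm : cornerSum n x * cornerSum n y ≤ 256 := by nlinarith
  have hm0 := mul_nonneg hx'.1 hy'.1
  rw [green, Fin.sum_univ_four, abs_le]
  constructor <;> linarith

variable {f : ℂ → ℝ}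

theorem integrableOn_VS (hn : 2 ≤ n) (hf : ContinuousOn f (VS n)) :
    IntegrableOn f (VS n) (stdMeasure n) :=
  hf.integrableOn_compact (isCompact_VS hn)

theorem renormEnergy_integral (hn : 2 ≤ n) (m : ℕ) (hf : ContinuousOn f (VS n)) (v : ℂ → ℝ) :
    renormEnergy n m (fun x => ∫ y in VS n, green n x y * f y ∂stdMeasure n) v =
      ∫ y in VS n, renormEnergy n m (fun x => green n x y) v * f y ∂stdMeasure n := by
  have hi : ∀ x ∈ VS n, Integrable (fun y => green n x y * f y) ((stdMeasure n).restrict (VS n)) :=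
    fun x hx => integrableOn_VS hn ((green_continuousOn_right hn hx).mul hf)
  have hw : ∀ (w : Fin m → Idx n) (j : Fin 4), wordMap n w (corner j) ∈ VS n := fun w j =>
    wordMap_mem_VS hn w (corner_mem_VS j)
  have hterm : ∀ (w : Fin m → Idx n) (i j : Fin 4),
      Integrable (fun y => (green n (wordMap n w (corner i)) y - green n (wordMap n w (corner j)) y) *
        (v (wordMap n w (corner i)) - v (wordMap n w (corner j))) * f y)
        ((stdMeasure n).restrict (VS n)) := fun w i j => by
    convert ((hi _ (hw w i)).sub (hi _ (hw w j))).mul_const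
      (v (wordMap n w (corner i)) - v (wordMap n w (corner j))) using 2
    simp only [Pi.sub_apply]; ring
  simp only [renormEnergy, graphEnergy, mul_assoc, Finset.sum_mul]
  rw [integral_const_mul, integral_const_mul]
  congr 2
  simp only [← mul_assoc]
  rw [integral_finsetSum _ fun w _ => integrable_finsetSum _ fun i _ =>
    integrable_finsetSum _ fun j _ => hterm w i j]
  refine Finset.sum_congr rfl fun w _ => ?_
  rw [integral_finsetSum _ fun i _ => integrable_finsetSum _ fun j _ => hterm w i j]
  refine Finset.sum_congr rfl fun i _ => ?_
  rw [integral_finsetSum _ fun j _ => hterm w i j]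
  refine Finset.sum_congr rfl fun j _ => ?_
  rw [← integral_sub (hi _ (hw w i)) (hi _ (hw w j)), ← integral_mul_const]
  refine integral_congr_ae (Eventually.of_forall fun y => ?_)
  dsimp only
  ring

/-- At each level the energy is a finite sum and commutes with the integral. Uniform convergence in
y supplies the dominating function (|v| + 1)|f| for the passage to the limit. -/
theorem hasEnergy_integral (hn : 2 ≤ n) (hf : ContinuousOn f (VS n)) (hv : ContinuousOn v (VS n))
    (hv0 : ∀ j, v (corner j) = 0) :
    HasEnergy n (fun x => ∫ y in VS n, green n x y * f y ∂stdMeasure n) v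
      (∫ y in VS n, f y * v y ∂stdMeasure n) := by
  unfold HasEnergy
  simp only [renormEnergy_integral hn _ hf]
  have hmeas : MeasurableSet (VS n) := isClosed_VS.measurableSet
  have hcont : ∀ m, ContinuousOn (fun y => renormEnergy n m (fun x => green n x y) v) (VS n) := by
    intro m
    have : ∀ (w : Fin m → Idx n) (j : Fin 4),
        ContinuousOn (fun y => green n (wordMap n w (corner j)) y) (VS n) := fun w j =>
      green_continuousOn_right hn (wordMap_mem_VS hn w (corner_mem_VS j))
    unfold renormEnergy graphEnergy
    fun_prop
  obtain ⟨N, hN⟩ := abs_renormEnergy_green_sub_le hn hv hv0 one_pos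
  refine tendsto_integral_filter_of_dominated_convergence (fun y => (|v y| + 1) * |f y|) ?_ ?_ ?_ ?_
  · exact Eventually.of_forall fun m => ((hcont m).mul hf).aestronglyMeasurable hmeas
  · filter_upwards [eventually_ge_atTop N] with m hm
    refine (ae_restrict_iff' hmeas).2 (Eventually.of_forall fun y hy => ?_)
    rw [norm_mul, Real.norm_eq_abs, Real.norm_eq_abs]
    refine mul_le_mul_of_nonneg_right ?_ (abs_nonneg _)
    have h1 := abs_le.1 (hN m hm y hy)
    have h2 := neg_abs_le (v y)
    have h3 := le_abs_self (v y)
    rw [abs_le]; constructor <;> linarith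
  · exact integrableOn_VS hn ((hv.abs.add continuousOn_const).mul hf.abs)
  · refine (ae_restrict_iff' hmeas).2 (Eventually.of_forall fun y hy => ?_)
    rw [mul_comm (f y)]
    exact (hasEnergy_green hn hy hv hv0).mul_const _

theorem integral_green_continuousOn (hn : 2 ≤ n) (hf : ContinuousOn f (VS n)) :
    ContinuousOn (fun x => ∫ y in VS n, green n x y * f y ∂stdMeasure n) (VS n) := by
  have hmeas : MeasurableSet (VS n) := isClosed_VS.measurableSet
  refine continuousOn_of_dominated (bound := fun y => 200 * |f y|) (fun x hx => ?_) (fun x hx => ?_)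
    ?_ ?_
  · exact ((green_continuousOn_right hn hx).mul hf).aestronglyMeasurable hmeas
  · refine (ae_restrict_iff' hmeas).2 (Eventually.of_forall fun y hy => ?_)
    rw [norm_mul]
    exact mul_le_mul_of_nonneg_right (abs_green_le hn hx hy) (abs_nonneg _)
  · exact integrableOn_VS hn (continuousOn_const.mul hf.abs)
  · refine (ae_restrict_iff' hmeas).2 (Eventually.of_forall fun y hy => ?_)
    exact (green_continuousOn hn hy).mul continuousOn_const

theorem inDomZero_integral_green (hn : 2 ≤ n) (hf : ContinuousOn f (VS n)) :
    InDomZero n (fun x => ∫ y in VS n, green n x y * f y ∂stdMeasure n) := by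
  have h0 : ∀ j, ∫ y in VS n, green n (corner j) y * f y ∂stdMeasure n = 0 := fun j => by
    simp [green_corner hn]
  exact ⟨⟨integral_green_continuousOn hn hf, _,
    hasEnergy_integral hn hf (integral_green_continuousOn hn hf) h0⟩, h0⟩

theorem hasLaplacian_integral_green (hn : 2 ≤ n) (hf : ContinuousOn f (VS n)) :
    HasLaplacian n (fun x => ∫ y in VS n, green n x y * f y ∂stdMeasure n) (fun x => -f x) := by
  refine ⟨hf.neg, (inDomZero_integral_green hn hf).1, fun v hv => ?_⟩
  simpa only [neg_mul, integral_neg, neg_neg] using hasEnergy_integral hn hf hv.1.1 hv.2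

theorem HasEnergy.congr_left (hn : 2 ≤ n) {e : ℝ} (h : HasEnergy n u v e)
    (huv : ∀ x ∈ VS n, u' x = u x) : HasEnergy n u' v e := by
  simpa only [HasEnergy, renormEnergy_congr hn _ huv fun _ _ => rfl] using h

theorem InDomZero.congr (hn : 2 ≤ n) (h : InDomZero n u) (huv : ∀ x ∈ VS n, u' x = u x) :
    InDomZero n u' := by
  obtain ⟨⟨h1, e, h2⟩, h3⟩ := h
  refine ⟨⟨h1.congr huv, e, ?_⟩, fun j => by rw [huv _ (corner_mem_VS j), h3]⟩
  exact ((h2.congr_left hn huv).symm.congr_left hn huv).symm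

theorem HasLaplacian.congr_left (hn : 2 ≤ n) (h : HasLaplacian n u f)
    (huv : ∀ x ∈ VS n, u' x = u x) : HasLaplacian n u' f := by
  obtain ⟨h1, ⟨h2, e, h3⟩, h4⟩ := h
  exact ⟨h1, ⟨h2.congr huv, e, ((h3.congr_left hn huv).symm.congr_left hn huv).symm⟩,
    fun v hv => (h4 v hv).congr_left hn huv⟩

end Vicsek

end

noncomputable section
namespace Vicsek
variable {n : ℕ} {x y z p q : ℂ}

/-! ## The explicit formula -/

theorem OnArm.exists_eq (hn : 2 ≤ n) {i : Fin 4} (h : OnArm n i x) (hz : AttachesAt n x z) :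
    ∃ s : ℝ, 0 ≤ s ∧ s ≤ 1 ∧ z = s * corner i := by
  obtain ⟨-, w, hw, hxw⟩ := h
  rw [hz.unique hn hxw]
  exact mem_halfDiagonal.1 hw

theorem pathDist_zero_axis (hn : 2 ≤ n) (j : Fin 4) {s : ℝ} (hs0 : 0 ≤ s) (hs : s ≤ 1) :
    pathDist n 0 (s * corner j) = s := by
  have := pathDist_axis hn j (a := 0) (b := s) (by simp) (by rwa [abs_of_nonneg hs0])
  simpa [abs_of_nonneg hs0] using this

theorem AttachesAt.pathDist_corner (hn : 2 ≤ n) (hx : x ∈ VS n) {i : Fin 4} {s : ℝ} (hs0 : 0 ≤ s)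
    (hs : s ≤ 1) (h : AttachesAt n x (s * corner i)) (k : Fin 4) :
    Vicsek.pathDist n x (corner k) =
      Vicsek.pathDist n x (s * corner i) + if i = k then 1 - s else 1 + s := by
  rw [h.pathDist hn hx (corner_mem_diagonals k)]
  congr 1
  split_ifs with hik
  · subst hik
    have := pathDist_axis hn i (a := s) (b := 1) (by rwa [abs_of_nonneg hs0]) (by simp)
    rw [Complex.ofReal_one, one_mul] at this
    rw [this, abs_sub_comm, abs_of_nonneg (by linarith)]
  · have := pathDist_diagonals hn hik hs0 hs zero_le_one le_rfl
    rw [Complex.ofReal_one, one_mul] at this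
    rw [this, add_comm]

/-- All corner distances are determined by the attachment points. Besides terms in s and t, what
remains is the Gromov product of x and y at the centre, the only place where d(x,y) enters. -/
theorem green_eq (hn : 2 ≤ n) (hx : x ∈ VS n) (hy : y ∈ VS n) {i j : Fin 4} {s t : ℝ}
    (hs0 : 0 ≤ s) (hs : s ≤ 1) (ht0 : 0 ≤ t) (ht : t ≤ 1)
    (hxs : AttachesAt n x (s * corner i)) (hyt : AttachesAt n y (t * corner j)) :
    green n x y = (pathDist n x (s * corner i) + s + (pathDist n y (t * corner j) + t) -
      pathDist n x y) / 2 - (if i = j then s * t else 0) + (1 - s) * (1 - t) / 4 := by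
  simp only [green, cornerSum, hxs.pathDist_corner hn hx hs0 hs, hyt.pathDist_corner hn hy ht0 ht,
    Fin.sum_univ_four]
  fin_cases i <;> fin_cases j <;> simp <;> ring

theorem green_of_ne_arm (hn : 2 ≤ n) (hx : x ∈ VS n) (hy : y ∈ VS n) {i j : Fin 4} {s t : ℝ}
    (hs0 : 0 ≤ s) (hs : s ≤ 1) (ht0 : 0 ≤ t) (ht : t ≤ 1)
    (hxs : AttachesAt n x (s * corner i)) (hyt : AttachesAt n y (t * corner j)) (hij : i ≠ j) :
    green n x y = (1 - s) * (1 - t) / 4 := by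
  have hd : pathDist n x y = pathDist n x (s * corner i) + (s + t) + pathDist n y (t * corner j) := by
    -- Attachment points on different arms coincide only at the centre, and then x is the centre.
    by_cases hne : (s : ℂ) * corner i = t * corner j
    · have h1 := congrArg (coord i) hne
      rw [coord_mul, coord_mul, coord_corner_self] at h1
      have h2 := coord_corner_nonpos hij.symm
      obtain rfl : s = 0 := by nlinarith
      have h0 : (((0 : ℝ) : ℂ)) * corner i = 0 := by simp
      rw [h0] at hxs
      obtain rfl := hxs.eq_zero hn hx
      rw [h0, pathDist_self hn hx, pathDist_comm, hyt.pathDist hn hy zero_mem_diagonals,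
        pathDist_comm n _ 0, pathDist_zero_axis hn j ht0 ht]
      ring
    · rw [hxs.pathDist_of_ne hn hx hy hyt hne, pathDist_diagonals hn hij hs0 hs ht0 ht]
  rw [green_eq hn hx hy hs0 hs ht0 ht hxs hyt, hd, if_neg hij]
  ring

theorem green_of_lt (hn : 2 ≤ n) (hx : x ∈ VS n) (hy : y ∈ VS n) {i : Fin 4} {s t : ℝ}
    (hs0 : 0 ≤ s) (hs : s ≤ 1) (ht0 : 0 ≤ t) (ht : t ≤ 1)
    (hxs : AttachesAt n x (s * corner i)) (hyt : AttachesAt n y (t * corner i)) (hst : s < t) :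
    green n x y = (1 - t) * (3 * s + 1) / 4 := by
  have hne : (s : ℂ) * corner i ≠ t * corner i := by
    intro hne
    have h1 := congrArg (coord i) hne
    rw [coord_mul, coord_mul, coord_corner_self] at h1
    linarith
  rw [green_eq hn hx hy hs0 hs ht0 ht hxs hyt, hxs.pathDist_of_ne hn hx hy hyt hne,
    pathDist_axis hn i (by rwa [abs_of_nonneg hs0]) (by rwa [abs_of_nonneg ht0]), abs_sub_comm,
    abs_of_pos (sub_pos.2 hst), if_pos rfl]
  ring

theorem green_of_isLastCommon (hn : 2 ≤ n) (hx : x ∈ VS n) (hy : y ∈ VS n) {i : Fin 4} {s : ℝ}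
    (hs0 : 0 ≤ s) (hs : s ≤ 1)
    (hxs : AttachesAt n x (s * corner i)) (hys : AttachesAt n y (s * corner i)) :
    ∃ w, IsLastCommon n (s * corner i) x y w ∧
      (∀ w', IsLastCommon n (s * corner i) x y w' → w' = w) ∧
      green n x y = (1 - s) * (3 * s + 1) / 4 + pathDist n (s * corner i) w := by
  obtain ⟨w, h1, h2, h3⟩ := exists_isLastCommon hn hx hy hxs.1
  refine ⟨w, h1, h2, ?_⟩
  rw [green_eq hn hx hy hs0 hs hs0 hs hxs hys, h3, if_pos rfl]
  ring

end Vicsek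

end

/-! ### The theorem -/

theorem mainTheorem4 (n : ℕ) (hn : 2 ≤ n) :
    -- attachment points are well defined, and every point lies on an arm
    (∀ x ∈ Vicsek.VS n, (∃! z : ℂ, Vicsek.AttachesAt n x z) ∧ ∃ i : Fin 4, Vicsek.OnArm n i x) ∧
    -- the Green's function exists
    (∃ G : ℂ → ℂ → ℝ, Vicsek.IsDirichletGreen n G) ∧
    ∀ G : ℂ → ℂ → ℝ, Vicsek.IsDirichletGreen n G →
      -- integration against it solves the Dirichlet problem
      (∀ f : ℂ → ℝ, ContinuousOn f (Vicsek.VS n) →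
        Vicsek.InDomZero n
          (fun x => ∫ y in Vicsek.VS n, G x y * f y ∂(Vicsek.stdMeasure n)) ∧
        Vicsek.HasLaplacian n
          (fun x => ∫ y in Vicsek.VS n, G x y * f y ∂(Vicsek.stdMeasure n))
          (fun x => -f x)) ∧
      -- the explicit formula
      ∀ x ∈ Vicsek.VS n, ∀ y ∈ Vicsek.VS n, ∀ zx zy : ℂ,
        Vicsek.AttachesAt n x zx → Vicsek.AttachesAt n y zy →
        ∀ i j : Fin 4, Vicsek.OnArm n i x → Vicsek.OnArm n j y →
          (i ≠ j →
            G x y = (1 - Vicsek.pathDist n 0 zx) * (1 - Vicsek.pathDist n 0 zy) / 4) ∧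
          (i = j → Vicsek.pathDist n 0 zx < Vicsek.pathDist n 0 zy →
            G x y = (1 - Vicsek.pathDist n 0 zy) * (3 * Vicsek.pathDist n 0 zx + 1) / 4) ∧
          (i = j → Vicsek.pathDist n 0 zy < Vicsek.pathDist n 0 zx →
            G x y = (1 - Vicsek.pathDist n 0 zx) * (3 * Vicsek.pathDist n 0 zy + 1) / 4) ∧
          (i = j → Vicsek.pathDist n 0 zx = Vicsek.pathDist n 0 zy →
            ∃ w : ℂ, Vicsek.IsLastCommon n zy x y w ∧
              (∀ w' : ℂ, Vicsek.IsLastCommon n zy x y w' → w' = w) ∧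
              G x y = (1 - Vicsek.pathDist n 0 zy) * (3 * Vicsek.pathDist n 0 zy + 1) / 4
                + Vicsek.pathDist n zy w) := by
  refine ⟨fun x hx => ⟨?_, Vicsek.exists_onArm hn hx⟩,
    ⟨Vicsek.green n, Vicsek.isDirichletGreen_green hn⟩, fun G hG => ⟨fun f hf => ?_, ?_⟩⟩
  · obtain ⟨z, hz⟩ := Vicsek.exists_attachesAt hn hx
    exact ⟨z, hz, fun w hw => hw.unique hn hz⟩
  · have h : ∀ x ∈ Vicsek.VS n, ∫ y in Vicsek.VS n, G x y * f y ∂(Vicsek.stdMeasure n) =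
        ∫ y in Vicsek.VS n, Vicsek.green n x y * f y ∂(Vicsek.stdMeasure n) := fun x hx =>
      setIntegral_congr_fun Vicsek.isClosed_VS.measurableSet fun y hy => by
        simp only [hG.eq_green hn hx hy]
    exact ⟨(Vicsek.inDomZero_integral_green hn hf).congr hn h,
      (Vicsek.hasLaplacian_integral_green hn hf).congr_left hn h⟩
  · intro x hx y hy zx zy hzx hzy i j hi hj
    obtain ⟨s, hs0, hs, rfl⟩ := hi.exists_eq hn hzx
    obtain ⟨t, ht0, ht, rfl⟩ := hj.exists_eq hn hzy
    rw [hG.eq_green hn hx hy, Vicsek.pathDist_zero_axis hn i hs0 hs,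
      Vicsek.pathDist_zero_axis hn j ht0 ht]
    refine ⟨fun hij => ?_, ?_, ?_, ?_⟩
    · exact Vicsek.green_of_ne_arm hn hx hy hs0 hs ht0 ht hzx hzy hij
    · rintro rfl hst
      exact Vicsek.green_of_lt hn hx hy hs0 hs ht0 ht hzx hzy hst
    · rintro rfl hst
      rw [Vicsek.green_comm]
      exact Vicsek.green_of_lt hn hy hx ht0 ht hs0 hs hzy hzx hst
    · rintro rfl rfl
      exact Vicsek.green_of_isLastCommon hn hx hy hs0 hs hzx hzy
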